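/- **Theorem 3.7.** Let $\Gamma=(m_{i,j})_{i,j\in I}$ be a Coxeter matrix over an arbitrary (possibly infinite) set $I$, i.e. $m_{i,j}=m_{j,i}\in\mathbb N_{\ge 1}\cup\{\infty\}$ and $m_{i,j}=1\Leftrightarrow i=j$. Let $W_\Gamma$ be its Coxeter group with standard generators $s_i$ ($i \in I$) and standard length $\ell$. Let $B^+_\Gamma$ (resp. $B_\Gamma$) be the Artin–Tits monoid (resp. group) of type $\Gamma$, presented as a monoid (resp. group) by generators $\mathbf s_i$ ($i\in I$) and the relations $\mathbf s_i\mathbf s_j\mathbf s_i\cdots=\mathbf s_j\mathbf s_i\mathbf s_j\cdots$ ($m_{i,j}$ factors on each side) for all $i,j$ with $m_{i,j}\ne\infty$. For $\alpha\subseteq I$ let $W_\alpha=\langle s_i\mid i\in\alpha\rangle\subseteq W_\Gamma$; call $\alpha$ spherical if $W_\alpha$ is finite, and call $\Gamma$ spherical if $W_\Gamma$ is finite. If $\alpha$ is spherical, let $r_\alpha$ be the unique element of maximal length in $W_\alpha$, and let $\mathbf r_\alpha\in B^+_\Gamma$ be the element represented by any reduced word of $r_\alpha$; the image of $\mathbf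 r_\alpha$ under the canonical morphism $B^+_\Gamma\to B_\Gamma$ is denoted by $\mathbf r_\alpha$ too. Let $G$ be a subgroup of $\mathrm{Aut}(\Gamma)=\{g\in\mathrm{Sym}(I)\mid m_{g(i),g(j)}=m_{i,j}\text{ for all }i,j\in I\}$, acting on $B^+_\Gamma$ and on $B_\Gamma$ by $\mathbf s_i\mapsto\mathbf s_{g(i)}$. Let $\tilde J$ be the set of all spherical orbits of $I$ under $G$, and let $J \subseteq I$ be their union. Then $\tilde J$ is an admissible partition of $\Gamma_J=(m_{i,j})_{i,j\in J}$: it consists of non-empty, pairwise disjoint spherical sets, and for every $w$ in the subgroup of $W_\Gamma$ generated by the $r_\alpha$ ($\alpha\in\tilde J$) and every $\alpha\in\tilde J$, either $\ell(ws_i)=\ell(w)+1$ for all $i\in\alpha$, or $\ell(ws_i)=\ell(w)-1$ for all $i\in\alpha$. Its type $\tilde\Gamma=(|r_\alpha r_\beta|)_{\alpha,\beta\in\tilde J}$, where $|r_\alpha r_\beta|\in\mathbb N_{\ge1}\cup\{\infty\}$ is the order of $r_\alpha r_\beta$ in $W_\Gamma$, is a Coxeter matrix over $\tilde J$. Moreover: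 1. The submonoid $(B^+_\Gamma)^G$ of elements fixed by $G$ equals the submonoid of $B^+_\Gamma$ generated by the $\mathbf r_\alpha$ ($\alpha\in\tilde J$), and there is a monoid isomorphism $B^+_{\tilde\Gamma}\to(B^+_\Gamma)^G$ sending $\mathbf s_\alpha$ to $\mathbf r_\alpha$ for every $\alpha\in\tilde J$. 2. If $\Gamma$ is spherical, the subgroup $(B_\Gamma)^G$ of elements fixed by $G$ equals the subgroup of $B_\Gamma$ generated by the $\mathbf r_\alpha$ ($\alpha\in\tilde J$), and there is a group isomorphism $B_{\tilde\Gamma}\to(B_\Gamma)^G$ sending $\mathbf s_\alpha$ to $\mathbf r_\alpha$ for every $\alpha\in\tilde J$. -/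

import Mathlib

/-! Artin-Tits monoids and groups, and fixed points of graph automorphisms.

Coxeter matrices are Mathlib's `CoxeterMatrix`: entries are natural numbers, and the entry `0`
stands for `∞`.  The Coxeter group `W` of `Γ` is `Γ.Group`, with standard generators
`Γ.simple i` and standard length `Γ.toCoxeterSystem.length`. -/

namespace ArtinTits

/-- The alternating product `x y x y ⋯` with `n` factors, starting with `x`. -/
def altProd {M : Type*} [Monoid M] : ℕ → M → M → M
  | 0, _, _ => 1
  | n + 1, x, y => x * altProd n y x

theorem map_altProd {M N F : Type*} [Monoid M] [Monoid N] [FunLike F M N]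
    [MonoidHomClass F M N] (f : F) (n : ℕ) (x y : M) :
    f (altProd n x y) = altProd n (f x) (f y) := by
  induction n generalizing x y with
  | zero => simp [altProd]
  | succ n ih => simp [altProd, ih]

section Presentations

variable {I : Type*}

/-- The defining relations `∏_{m i j}(i, j) = ∏_{m i j}(j, i)`, for `m i j ≠ ∞`, of the
Artin-Tits monoid, on the free monoid on `I`. -/
def monoidRel (Γ : CoxeterMatrix I) (u v : FreeMonoid I) : Prop :=
  ∃ i j : I, Γ i j ≠ 0 ∧
    u = altProd (Γ i j) (FreeMonoid.of i) (FreeMonoid.of j) ∧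
    v = altProd (Γ i j) (FreeMonoid.of j) (FreeMonoid.of i)

/-- The (positive) Artin-Tits monoid `B⁺` of type `Γ`. -/
abbrev PosMonoid (Γ : CoxeterMatrix I) : Type _ := PresentedMonoid (monoidRel Γ)

/-- The standard generators of the Artin-Tits monoid. -/
def PosMonoid.gen (Γ : CoxeterMatrix I) (i : I) : PosMonoid Γ :=
  PresentedMonoid.of (monoidRel Γ) i

/-- The defining relators of the Artin-Tits group. -/
def groupRels (Γ : CoxeterMatrix I) : Set (FreeGroup I) :=
  {u | ∃ i j : I, Γ i j ≠ 0 ∧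
    u = altProd (Γ i j) (FreeGroup.of i) (FreeGroup.of j) *
      (altProd (Γ i j) (FreeGroup.of j) (FreeGroup.of i))⁻¹}

/-- The Artin-Tits group `B` of type `Γ`. -/
abbrev ArtinGroup (Γ : CoxeterMatrix I) : Type _ := PresentedGroup (groupRels Γ)

/-- The standard generators of the Artin-Tits group. -/
def ArtinGroup.gen (Γ : CoxeterMatrix I) (i : I) : ArtinGroup Γ :=
  PresentedGroup.of i

theorem PosMonoid.gen_braid (Γ : CoxeterMatrix I) (i j : I) (h : Γ i j ≠ 0) :
    altProd (Γ i j) (PosMonoid.gen Γ i) (PosMonoid.gen Γ j) =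
      altProd (Γ i j) (PosMonoid.gen Γ j) (PosMonoid.gen Γ i) := by
  have := PresentedMonoid.mk_eq_mk_of_rel (rels := monoidRel Γ) ⟨i, j, h, rfl, rfl⟩
  rwa [map_altProd, map_altProd] at this

theorem ArtinGroup.gen_braid (Γ : CoxeterMatrix I) (i j : I) (h : Γ i j ≠ 0) :
    altProd (Γ i j) (ArtinGroup.gen Γ i) (ArtinGroup.gen Γ j) =
      altProd (Γ i j) (ArtinGroup.gen Γ j) (ArtinGroup.gen Γ i) := by
  have := PresentedGroup.mk_eq_mk_of_mul_inv_mem (rels := groupRels Γ) ⟨i, j, h, rfl⟩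
  rwa [map_altProd, map_altProd] at this

/-- Universal property of the Artin-Tits monoid. -/
def PosMonoid.lift (Γ : CoxeterMatrix I) {N : Type*} [Monoid N] (f : I → N)
    (hf : ∀ i j, Γ i j ≠ 0 → altProd (Γ i j) (f i) (f j) = altProd (Γ i j) (f j) (f i)) :
    PosMonoid Γ →* N :=
  PresentedMonoid.lift f (by
    rintro a b ⟨i, j, h, rfl, rfl⟩
    simpa [map_altProd] using hf i j h)

/-- Universal property of the Artin-Tits group. -/
def ArtinGroup.lift (Γ : CoxeterMatrix I) {N : Type*} [Group N] (f : I → N)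
    (hf : ∀ i j, Γ i j ≠ 0 → altProd (Γ i j) (f i) (f j) = altProd (Γ i j) (f j) (f i)) :
    ArtinGroup Γ →* N :=
  PresentedGroup.toGroup (f := f) (by
    rintro a ⟨i, j, h, rfl⟩
    simp [map_altProd, hf i j h])

/-- The canonical morphism `B⁺ → B`, sending each standard generator to the standard generator
with the same index. -/
def toArtinGroup (Γ : CoxeterMatrix I) : PosMonoid Γ →* ArtinGroup Γ :=
  PosMonoid.lift Γ (ArtinGroup.gen Γ) (ArtinGroup.gen_braid Γ)

end Presentations

section Automorphisms

variable {I : Type*}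

/-- The automorphism group of the Coxeter matrix `Γ`: the permutations `g` of the index set with
`m (g i) (g j) = m i j`. -/
def Aut (Γ : CoxeterMatrix I) : Subgroup (Equiv.Perm I) where
  carrier := {g | ∀ i j, Γ (g i) (g j) = Γ i j}
  one_mem' := fun _ _ => rfl
  mul_mem' := by
    intro a b ha hb i j
    simp only [Set.mem_ofPred_eq] at ha hb
    simp [ha, hb]
  inv_mem' := by
    intro a ha i j
    have := ha (a⁻¹ i) (a⁻¹ j)
    simpa using this.symm

/-- The endomorphism (in fact automorphism) of `B⁺` induced by `g ∈ Aut Γ`, sending the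
generator of index `i` to the generator of index `g i`. -/
def posMonoidAct (Γ : CoxeterMatrix I) (g : Aut Γ) : PosMonoid Γ →* PosMonoid Γ :=
  PosMonoid.lift Γ (fun i => PosMonoid.gen Γ (g • i)) (by
    intro i j h
    have e : Γ (g • i) (g • j) = Γ i j := g.2 i j
    have := PosMonoid.gen_braid Γ (g • i) (g • j) (by rwa [e])
    rwa [e] at this)

/-- The endomorphism (in fact automorphism) of `B` induced by `g ∈ Aut Γ`, sending the
generator of index `i` to the generator of index `g i`. -/
def artinGroupAct (Γ : CoxeterMatrix I) (g : Aut Γ) : ArtinGroup Γ →* ArtinGroup Γ :=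
  ArtinGroup.lift Γ (fun i => ArtinGroup.gen Γ (g • i)) (by
    intro i j h
    have e : Γ (g • i) (g • j) = Γ i j := g.2 i j
    have := ArtinGroup.gen_braid Γ (g • i) (g • j) (by rwa [e])
    rwa [e] at this)

/-- The submonoid of `B⁺` of the elements fixed by `G`. -/
def fixedSubmonoid (Γ : CoxeterMatrix I) (G : Subgroup (Aut Γ)) : Submonoid (PosMonoid Γ) where
  carrier := {x | ∀ g ∈ G, posMonoidAct Γ g x = x}
  one_mem' := fun g _ => map_one _
  mul_mem' := by
    intro a b ha hb g hg
    rw [map_mul, ha g hg, hb g hg]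

/-- The subgroup of `B` of the elements fixed by `G`. -/
def fixedSubgroup (Γ : CoxeterMatrix I) (G : Subgroup (Aut Γ)) : Subgroup (ArtinGroup Γ) where
  carrier := {x | ∀ g ∈ G, artinGroupAct Γ g x = x}
  one_mem' := fun g _ => map_one _
  mul_mem' := by
    intro a b ha hb g hg
    rw [map_mul, ha g hg, hb g hg]
  inv_mem' := by
    intro a ha g hg
    rw [map_inv, ha g hg]

end Automorphisms

section Spherical

variable {I : Type*}

/-- The standard parabolic subgroup `W_J` of the Coxeter group. -/
def parabolic (Γ : CoxeterMatrix I) (J : Set I) : Subgroup Γ.Group :=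
  Subgroup.closure (Γ.simple '' J)

/-- `J ⊆ I` is spherical if `W_J` is finite. -/
def IsSpherical (Γ : CoxeterMatrix I) (J : Set I) : Prop :=
  (parabolic Γ J : Set Γ.Group).Finite

/-- `w` is an element of maximal standard length in `W_J`. -/
def IsLongest (Γ : CoxeterMatrix I) (J : Set I) (w : Γ.Group) : Prop :=
  w ∈ parabolic Γ J ∧
    ∀ v ∈ parabolic Γ J, Γ.toCoxeterSystem.length v ≤ Γ.toCoxeterSystem.length w

theorem exists_isLongest {Γ : CoxeterMatrix I} {J : Set I} (h : IsSpherical Γ J) :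
    ∃ w, IsLongest Γ J w := by
  obtain ⟨w, hw, hmax⟩ := Set.exists_max_image (parabolic Γ J : Set Γ.Group)
    Γ.toCoxeterSystem.length h ⟨1, (parabolic Γ J).one_mem⟩
  exact ⟨w, hw, hmax⟩

/-- The element `r_J` of maximal standard length in `W_J`, for `J` spherical (this element is
unique, so that the choice made here is immaterial). -/
noncomputable def longest (Γ : CoxeterMatrix I) {J : Set I} (h : IsSpherical Γ J) : Γ.Group :=
  (exists_isLongest h).choose

theorem longest_spec (Γ : CoxeterMatrix I) {J : Set I} (h : IsSpherical Γ J) :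
    IsLongest Γ J (longest Γ h) :=
  (exists_isLongest h).choose_spec

theorem exists_reduced (Γ : CoxeterMatrix I) (w : Γ.Group) :
    ∃ ω : List I, ω.length = Γ.toCoxeterSystem.length w ∧
      Γ.toCoxeterSystem.wordProd ω = w := by
  obtain ⟨ω, h, rfl⟩ := Γ.toCoxeterSystem.exists_isReduced w
  exact ⟨ω, h.symm, rfl⟩

/-- The simple element of `B⁺` attached to `w`: the element represented by a reduced word of `w`
(two reduced words of `w` differ by braid relations, so that the choice made here is
immaterial). -/
noncomputable def simpleElt (Γ : CoxeterMatrix I) (w : Γ.Group) : PosMonoid Γ :=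
  ((exists_reduced Γ w).choose.map (PosMonoid.gen Γ)).prod

/-- The element `r_J` of the Artin-Tits monoid `B⁺`, for `J` spherical. -/
noncomputable def posLongest (Γ : CoxeterMatrix I) {J : Set I} (h : IsSpherical Γ J) :
    PosMonoid Γ :=
  simpleElt Γ (longest Γ h)

/-- The element `r_J` of the Artin-Tits group `B`, for `J` spherical. -/
noncomputable def artinLongest (Γ : CoxeterMatrix I) {J : Set I} (h : IsSpherical Γ J) :
    ArtinGroup Γ :=
  toArtinGroup Γ (posLongest Γ h)

/-- `I⁺(w)`, the set of `i` with `ℓ (w s_i) = ℓ w + 1`. -/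
def ascents (Γ : CoxeterMatrix I) (w : Γ.Group) : Set I :=
  {i | Γ.toCoxeterSystem.length (w * Γ.simple i) = Γ.toCoxeterSystem.length w + 1}

/-- `I⁻(w)`, the set of `i` with `ℓ (w s_i) = ℓ w - 1`. -/
def descents (Γ : CoxeterMatrix I) (w : Γ.Group) : Set I :=
  {i | Γ.toCoxeterSystem.length (w * Γ.simple i) + 1 = Γ.toCoxeterSystem.length w}

/-- `P` is an admissible partition of `Γ_J`, where `J` is the union of `P`: the members of `P`
are non-empty, pairwise disjoint and spherical, and for every `w` in the subgroup generated by the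
`r_α` (`α ∈ P`), each `α ∈ P` is contained in `I⁺(w)` or in `I⁻(w)`.  (The Coxeter group of `Γ_J`
is identified with `W_J`, whose standard length is the restriction of that of `W`.) -/
structure IsAdmissible (Γ : CoxeterMatrix I) (P : Set (Set I)) : Prop where
  nonempty : ∀ α ∈ P, α.Nonempty
  disjoint : P.PairwiseDisjoint id
  spherical : ∀ α ∈ P, IsSpherical Γ α
  ascents_or_descents :
    ∀ w ∈ Subgroup.closure {r | ∃ (α : Set I) (hα : α ∈ P), r = longest Γ (spherical α hα)},
      ∀ α ∈ P, α ⊆ ascents Γ w ∨ α ⊆ descents Γ w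

/-- The set of spherical orbits of `I` under `G`. -/
def sphericalOrbits (Γ : CoxeterMatrix I) (G : Subgroup (Aut Γ)) : Set (Set I) :=
  {α | (∃ i : I, α = MulAction.orbit G i) ∧ IsSpherical Γ α}

end Spherical

end ArtinTits

/-! Everything rests on two facts about left divisibility in B⁺. It is left cancellative, and if
every s_i with i ∈ D left-divides x, then D is spherical and r_D left-divides x
(`isSpherical_of_gen_dvd`, `posLongest_dvd`).

Generation. If x ≠ 1 is fixed by G and s_i divides x, then so does s_j for every j in the orbit α of
i. Hence α is spherical, r_α divides x, and by cancellation the quotient is again fixed. Induction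
on the degree expresses x through the r_α (`exists_orbitHom_eq`).

Relations. The left descents of a G-fixed element of W form a union of orbits, so an element of W_{α
∪ β} fixed by G is obtained by stripping r_α and r_β alternately, with lengths adding up. Applied to
the longest element when α ∪ β is spherical, this writes it as an alternating product in both
orders, with |r_α r_β| factors (`posLongest_union`). Conversely, a finite order of r_α r_β forces α
∪ β to be spherical. So the braid relations of the type hold in B⁺, and each side of such a relation
maps to r_{α ∪ β}. Injectivity then follows by a Matsumoto-style induction (`orbitHom_injective`).

Divisibility. Among the prefixes of w that can be appended to v with additive length there is a
greatest one (`exists_greatest_prefix`). Moving it from w to v defines an action of B⁺ on W × B⁺.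
The image of (1, 1) under x is a factorization of x whose simple part has as left descents all i
with s_i dividing x. This uses the exchange condition, the exact order of s_i s_j, and Matsumoto's
theorem.

Groups. If W is finite, the square of the longest element of B⁺ is central, fixed by G, and a
multiple of every generator. Hence B⁺ embeds in B and every element of B is a fraction with a power
of it as denominator. Its preimage under `orbitHom` plays the same role in the monoid of the type,
which carries the monoid statement over to groups. -/

namespace ArtinTits

/-! ### The geometric representation and the exact order of s_i s_j. -/

section GeometricRepresentation

open Polynomial.Chebyshev Module

variable {I : Type*} (Γ : CoxeterMatrix I)

/-- The linear form `v ↦ 2 B(e_i, v)` of the geometric representation. -/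
noncomputable def coroot (i : I) : Dual ℝ (I →₀ ℝ) :=
  Finsupp.linearCombination ℝ (fun j => -2 * Real.cos (Real.pi / Γ i j))

theorem coroot_single (i j : I) :
    coroot Γ i (Finsupp.single j 1) = -2 * Real.cos (Real.pi / Γ i j) := by
  simp [coroot]

theorem coroot_self (i : I) : coroot Γ i (Finsupp.single i 1) = 2 := by
  simp [coroot_single]

/-- The reflection of the geometric representation attached to a simple generator. -/
noncomputable def geomReflection (i : I) : (I →₀ ℝ) ≃ₗ[ℝ] (I →₀ ℝ) :=
  reflection (coroot_self Γ i)

theorem coroot_mul_coroot_sub_two (i j : I) :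
    coroot Γ i (Finsupp.single j 1) * coroot Γ j (Finsupp.single i 1) - 2 =
      2 * Real.cos (2 * (Real.pi / Γ i j)) := by
  rw [coroot_single, coroot_single, Γ.symmetric j i, Real.cos_two_mul]
  ring

theorem geomReflection_isLiftable : Γ.IsLiftable (geomReflection Γ) := by
  intro i j
  by_cases hij : i = j
  · subst hij
    rw [Γ.diagonal, pow_one]
    ext1 v
    exact involutive_reflection (coroot_self Γ i) v
  have h1 : Γ i j ≠ 1 := Γ.off_diagonal i j hij
  obtain h0 | h2 : Γ i j = 0 ∨ 2 ≤ Γ i j := by omega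
  · rw [h0, pow_zero]
  have hS := fun n : ℤ => S_two_mul_real_cos (2 * (Real.pi / Γ i j)) n
  have ht := coroot_mul_coroot_sub_two Γ i j
  have key := fun z => reflection_mul_reflection_pow_apply (coroot_self Γ i) (coroot_self Γ j)
    (Γ i j) z (2 * Real.cos (2 * (Real.pi / Γ i j)))
    (by rw [← ht, mul_comm])
  have hcos := coroot_single Γ i j
  have hcos' := coroot_single Γ j i
  rw [Γ.symmetric j i] at hcos'
  ext1 v
  rw [geomReflection, geomReflection, key]
  clear key ht
  generalize Γ i j = m at *
  have hpi := Real.pi_pos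
  have hm : (2 : ℝ) ≤ m := by exact_mod_cast h2
  -- With θ = 2π/m, the tool is S_n(2 cos θ) sin θ = sin((n+1)θ). It gives nothing for m = 2, where
  -- sin θ = 0, so that case is computed directly.
  obtain rfl | h3 : m = 2 ∨ 3 ≤ m := by omega
  · have : (2 : ℝ) * (Real.pi / (2 : ℕ)) = Real.pi := by push_cast; ring
    rw [this]
    norm_num at hcos hcos' ⊢
    simp [hcos, hcos']
    abel
  have hsin : Real.sin (2 * (Real.pi / m)) ≠ 0 := by
    have hm3 : (3 : ℝ) ≤ m := by exact_mod_cast h3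
    apply ne_of_gt
    apply Real.sin_pos_of_pos_of_lt_pi
    · positivity
    · rw [← mul_div_assoc, div_lt_iff₀ (by positivity)]
      nlinarith
  obtain ⟨k, rfl | rfl⟩ := Nat.even_or_odd' m
  · have e1 : (((2 * k : ℕ) : ℤ) - 2) / 2 = k - 1 := by omega
    have e2 : (((2 * k : ℕ) : ℤ) - 1) / 2 = k - 1 := by omega
    -- For m = 2k one has kθ = π, so S_{k-1} vanishes.
    have hz : (S ℝ ((k : ℤ) - 1)).eval (2 * Real.cos (2 * (Real.pi / (2 * k : ℕ)))) = 0 := by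
      have := hS (k - 1)
      have hk : (k : ℝ) ≠ 0 := by
        have : k ≠ 0 := by omega
        exact_mod_cast this
      rw [show (((k - 1 : ℤ) : ℝ) + 1) * (2 * (Real.pi / (2 * k : ℕ))) = Real.pi by
        push_cast; field_simp; ring] at this
      rw [Real.sin_pi] at this
      exact (mul_eq_zero.1 this).resolve_right hsin
    rw [e1, e2, hz]
    simp
  · have e1 : (((2 * k + 1 : ℕ) : ℤ) - 2) / 2 = k - 1 := by omega
    have e2 : (((2 * k + 1 : ℕ) : ℤ) - 1) / 2 = k := by omega
    have e3 : (((2 * k + 1 : ℕ) : ℤ) - 3) / 2 = k - 1 := by omega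
    have e4 : (((2 * k + 1 : ℕ) : ℤ)) / 2 = k := by omega
    -- For m = 2k+1 one has kθ + (k+1)θ = 2π, so the two sines cancel.
    have hz : (S ℝ (k : ℤ)).eval (2 * Real.cos (2 * (Real.pi / (2 * k + 1 : ℕ)))) +
        (S ℝ ((k : ℤ) - 1)).eval (2 * Real.cos (2 * (Real.pi / (2 * k + 1 : ℕ)))) = 0 := by
      have a := hS (k - 1)
      have b := hS k
      have hk : (k : ℝ) ≠ 0 := by
        have : k ≠ 0 := by omega
        exact_mod_cast this
      have hk' : (2 * (k : ℝ) + 1) ≠ 0 := by positivity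
      rw [show (((k - 1 : ℤ) : ℝ) + 1) * (2 * (Real.pi / (2 * k + 1 : ℕ))) =
        2 * Real.pi - (((k : ℤ) : ℝ) + 1) * (2 * (Real.pi / (2 * k + 1 : ℕ))) by
        push_cast; field_simp; ring, Real.sin_two_pi_sub, ← b] at a
      apply (mul_eq_zero.1 (?_ : _ * Real.sin (2 * (Real.pi / (2 * k + 1 : ℕ))) = 0)).resolve_right
        hsin
      linear_combination a
    rw [e1, e2, e3, e4, hz]
    simp

/-- If the n-th power fixed e_i, comparing coordinates would give sin(nθ) = 0 and sin((n+1)θ) = sin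
θ for θ = 2π/m, hence cos(nθ) = 1 and m ∣ n. The cases m = 2 and m = ∞ are separate. -/
theorem geomReflection_pow_ne_one {i j : I} (hij : i ≠ j) {n : ℕ} (hn : n ≠ 0)
    (hlt : Γ i j = 0 ∨ n < Γ i j) : (geomReflection Γ i * geomReflection Γ j) ^ n ≠ 1 := by
  intro h
  have h1 : Γ i j ≠ 1 := Γ.off_diagonal i j hij
  have hS := fun n : ℤ => S_two_mul_real_cos (2 * (Real.pi / Γ i j)) n
  have key := reflection_mul_reflection_pow_apply_self (coroot_self Γ i) (coroot_self Γ j)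
    n (2 * Real.cos (2 * (Real.pi / Γ i j)))
    (by rw [← coroot_mul_coroot_sub_two Γ i j])
  have hc := coroot_single Γ j i
  rw [Γ.symmetric j i] at hc
  change ((geomReflection Γ i * geomReflection Γ j) ^ n) _ = _ at key
  rw [h] at key
  have ki := DFunLike.congr_fun key i
  have kj := DFunLike.congr_fun key j
  simp [hij, hij.symm, -mul_eq_zero] at ki kj
  have hn0 : (n : ℝ) ≠ 0 := by exact_mod_cast hn
  obtain h0 | h2 : Γ i j = 0 ∨ 2 ≤ Γ i j := by omega
  · rw [h0] at kj hc
    -- For m = ∞, coded as 0, division by zero makes the angle 0 and the form value -2. The rotation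
    -- is then unipotent, and S_{n-1}(2) = n is nonzero.
    simp only [CharP.cast_eq_zero, div_zero, mul_zero, Real.cos_zero, mul_one] at kj hc
    rw [hc, S_eval_two] at kj
    push_cast at kj
    apply hn0
    linarith
  have hnm : n < Γ i j := by omega
  rw [hc] at kj
  clear hc key
  generalize Γ i j = m at *
  have hpi := Real.pi_pos
  have hm : (2 : ℝ) ≤ m := by exact_mod_cast h2
  obtain rfl | h3 : m = 2 ∨ 3 ≤ m := by omega
  · obtain rfl : n = 1 := by omega
    have : (2 : ℝ) * (Real.pi / (2 : ℕ)) = Real.pi := by push_cast; ring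
    rw [this] at ki
    norm_num at ki
  have hm3 : (3 : ℝ) ≤ m := by exact_mod_cast h3
  have hsin : Real.sin (2 * (Real.pi / m)) ≠ 0 := by
    apply ne_of_gt
    apply Real.sin_pos_of_pos_of_lt_pi
    · positivity
    · rw [← mul_div_assoc, div_lt_iff₀ (by positivity)]
      nlinarith
  have hcos : Real.cos (Real.pi / m) ≠ 0 := by
    apply ne_of_gt
    apply Real.cos_pos_of_mem_Ioo
    constructor
    · have : 0 < Real.pi / m := by positivity
      linarith
    · rw [div_lt_iff₀ (by positivity)]
      nlinarith
  have hz : (S ℝ ((n : ℤ) - 1)).eval (2 * Real.cos (2 * (Real.pi / m))) = 0 := by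
    rcases mul_eq_zero.1 kj with h | h
    · exact h
    · exact absurd h (by simpa using hcos)
  rw [hz, add_zero] at ki
  have a := hS (n - 1)
  have b := hS n
  rw [hz, zero_mul] at a
  rw [← ki, one_mul] at b
  push_cast at a b
  rw [sub_add_cancel] at a
  rw [add_mul, one_mul, Real.sin_add, ← a, zero_mul, zero_add] at b
  have hc1 : Real.cos (n * (2 * (Real.pi / m))) = 1 := by
    apply mul_right_cancel₀ hsin
    rw [one_mul, ← b]
  rw [Real.cos_eq_one_iff] at hc1
  obtain ⟨q, hq⟩ := hc1
  have hq' : (q : ℝ) * m = n := by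
    field_simp at hq
    linarith
  have hq'' : q * m = n := by exact_mod_cast hq'
  have hpos : 0 < q := by
    by_contra hle
    nlinarith [Nat.pos_of_ne_zero hn]
  nlinarith

/-- The relations only bound the order from above; the geometric representation excludes smaller
exponents. -/
theorem orderOf_simple_mul_simple (i j : I) :
    orderOf (Γ.toCoxeterSystem.simple i * Γ.toCoxeterSystem.simple j) = Γ i j := by
  by_cases hij : i = j
  · subst hij
    rw [CoxeterSystem.simple_mul_simple_self, orderOf_one, Γ.diagonal]
  have hdvd := orderOf_dvd_of_pow_eq_one (Γ.toCoxeterSystem.simple_mul_simple_pow i j)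
  by_contra hne
  have hpow := pow_orderOf_eq_one (Γ.toCoxeterSystem.simple i * Γ.toCoxeterSystem.simple j)
  by_cases ho : orderOf (Γ.toCoxeterSystem.simple i * Γ.toCoxeterSystem.simple j) = 0
  · rw [ho] at hdvd hne
    exact hne (Nat.eq_zero_of_zero_dvd hdvd).symm
  · have h := congrArg (Γ.toCoxeterSystem.lift ⟨_, geomReflection_isLiftable Γ⟩) hpow
    rw [map_pow, map_mul, Γ.toCoxeterSystem.lift_apply_simple,
      Γ.toCoxeterSystem.lift_apply_simple, map_one] at h
    refine geomReflection_pow_ne_one Γ hij ho ?_ h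
    by_cases h0 : Γ i j = 0
    · exact Or.inl h0
    · exact Or.inr (lt_of_le_of_ne (Nat.le_of_dvd (Nat.pos_of_ne_zero h0) hdvd) hne)

theorem simple_injective : Function.Injective Γ.simple := by
  intro i j h
  by_contra hij
  have := orderOf_simple_mul_simple Γ i j
  rw [Γ.toCoxeterSystem_simple, h, ← Γ.toCoxeterSystem_simple,
    CoxeterSystem.simple_mul_simple_self, orderOf_one] at this
  exact Γ.off_diagonal i j hij this.symm

end GeometricRepresentation

/-! ### The parity of inversions and the exchange condition. -/

section Exchange

open CoxeterSystem

variable {I : Type*} {Γ : CoxeterMatrix I} {W : Type*} [Group W] (cs : CoxeterSystem Γ W)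

open Classical in
/-- The action of a simple reflection on pairs (element, sign), used to count the parity of the
number of occurrences of an element in the inversion sequences of a word. -/
noncomputable def signedConj (i : I) : Function.End (W × ZMod 2) :=
  fun p => (cs.simple i * p.1 * cs.simple i, p.2 + if p.1 = cs.simple i then 1 else 0)

open Classical in
theorem prod_map_signedConj_apply (ω : List I) (t : W) (ε : ZMod 2) :
    (ω.map (signedConj cs)).prod (t, ε) =
      (cs.wordProd ω * t * (cs.wordProd ω)⁻¹, ε + ((cs.rightInvSeq ω).count t : ℕ)) := by
  induction ω with
  | nil => simp [Function.End.one_def]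
  | cons i ω ih =>
    rw [List.map_cons, List.prod_cons]
    change signedConj cs i ((ω.map (signedConj cs)).prod (t, ε)) = _
    rw [ih]
    simp only [signedConj, rightInvSeq, wordProd_cons, List.count_cons, mul_inv_rev, inv_simple,
      Prod.mk.injEq, beq_iff_eq]
    refine ⟨by simp only [mul_assoc], ?_⟩
    have : (cs.wordProd ω * t * (cs.wordProd ω)⁻¹ = cs.simple i) ↔
        ((cs.wordProd ω)⁻¹ * cs.simple i * cs.wordProd ω = t) := by
      constructor
      · intro h
        rw [← h]
        group
      · rintro rfl
        group
    simp only [this]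
    push_cast
    rw [add_assoc]

theorem reverse_alternatingWord_two_mul (i j : I) (m : ℕ) :
    (alternatingWord i j (2 * m)).reverse = alternatingWord j i (2 * m) := by
  induction m with
  | zero => simp [alternatingWord]
  | succ m ih =>
    rw [show 2 * (m + 1) = 2 * m + 1 + 1 by ring, alternatingWord_succ' j i,
      alternatingWord_succ' j i, alternatingWord_succ, alternatingWord_succ]
    simp [ih]

theorem prod_map_alternatingWord_two_mul {N : Type*} [Monoid N] (f : I → N) (i j : I) (m : ℕ) :
    ((alternatingWord i j (2 * m)).map f).prod = (f i * f j) ^ m := by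
  induction m with
  | zero => simp [alternatingWord]
  | succ m ih =>
    rw [show 2 * (m + 1) = 2 * m + 1 + 1 by ring, alternatingWord_succ, alternatingWord_succ]
    simp [ih, pow_succ]

theorem leftInvSeq_alternatingWord_two_mul (i j : I) (p : ℕ) :
    cs.leftInvSeq (alternatingWord i j (2 * p)) =
      (List.range (2 * p)).map fun k => cs.simple i * (cs.simple j * cs.simple i) ^ k := by
  apply List.ext_getElem
  · simp
  · intro k h1 h2
    have hk : k < 2 * p := by simpa using h1
    rw [getElem_leftInvSeq_alternatingWord cs i j p k hk, prod_alternatingWord_eq_mul_pow]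
    have : ¬ Even (2 * k + 1) := by simp
    have e : (2 * k + 1) / 2 = k := by omega
    simp [e]

open Classical in
theorem count_rightInvSeq_alternatingWord (i j : I) (t : W) :
    (((cs.rightInvSeq (alternatingWord i j (2 * Γ i j))).count t : ℕ) : ZMod 2) = 0 := by
  rw [← reverse_alternatingWord_two_mul, rightInvSeq_reverse, List.count_reverse,
    leftInvSeq_alternatingWord_two_mul, two_mul, List.range_add, List.map_append, List.map_map,
    List.count_append]
  -- Since (s_i s_j)^m = 1, the second half of the inversion sequence repeats the first, and all
  -- multiplicities are even.
  have : ((fun k => cs.simple j * (cs.simple i * cs.simple j) ^ k) ∘ fun x => Γ i j + x) =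
      fun k => cs.simple j * (cs.simple i * cs.simple j) ^ k := by
    funext k
    simp [pow_add]
  rw [this]
  push_cast
  exact CharTwo.add_self_eq_zero _

/-- The word (ij)^m has trivial product and meets every reflection an even number of times. Hence
the signed action factors through the group, and the parity of occurrences of t depends only on the
product of the word. -/
theorem signedConj_isLiftable : Γ.IsLiftable (signedConj cs) := by
  classical
  intro i j
  rw [← prod_map_alternatingWord_two_mul]
  funext p
  obtain ⟨t, ε⟩ := p
  rw [prod_map_signedConj_apply, count_rightInvSeq_alternatingWord, add_zero, wordProd,
    prod_map_alternatingWord_two_mul, simple_mul_simple_pow]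
  simp [Function.End.one_def]

/-- The parity of the number of occurrences of `t` in the right inversion sequence of any word
representing `w`. -/
noncomputable def inversionParity (w t : W) : ZMod 2 :=
  (cs.lift ⟨_, signedConj_isLiftable cs⟩ w (t, 0)).2

theorem lift_signedConj_wordProd (ω : List I) :
    cs.lift ⟨_, signedConj_isLiftable cs⟩ (cs.wordProd ω) = (ω.map (signedConj cs)).prod := by
  induction ω with
  | nil => simp
  | cons i ω ih => rw [wordProd_cons, map_mul, lift_apply_simple, ih, List.map_cons, List.prod_cons]

open Classical in
theorem inversionParity_wordProd (ω : List I) (t : W) :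
    inversionParity cs (cs.wordProd ω) t = ((cs.rightInvSeq ω).count t : ℕ) := by
  rw [inversionParity, lift_signedConj_wordProd, prod_map_signedConj_apply, zero_add]

theorem mem_rightInvSeq_of_inversionParity_ne_zero {ω : List I} {t : W}
    (h : inversionParity cs (cs.wordProd ω) t ≠ 0) : t ∈ cs.rightInvSeq ω := by
  classical
  by_contra hmem
  rw [inversionParity_wordProd, List.count_eq_zero_of_not_mem hmem] at h
  simp at h

/-- Appending s_i to a word conjugates its inversion sequence by s_i, which fixes s_i, and adds one
new entry s_i. -/
theorem inversionParity_mul_simple (w : W) (i : I) :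
    inversionParity cs (w * cs.simple i) (cs.simple i) =
      inversionParity cs w (cs.simple i) + 1 := by
  classical
  obtain ⟨ω, rfl⟩ := cs.wordProd_surjective w
  rw [← wordProd_concat, inversionParity_wordProd, inversionParity_wordProd, rightInvSeq_concat,
    List.concat_eq_append, List.count_append]
  have : List.count (cs.simple i) (List.map (MulAut.conj (cs.simple i)) (cs.rightInvSeq ω)) =
      List.count (cs.simple i) (cs.rightInvSeq ω) := by
    have h := List.count_map_of_injective (cs.rightInvSeq ω) _
      (MulAut.conj (cs.simple i)).injective (cs.simple i)
    rwa [show MulAut.conj (cs.simple i) (cs.simple i) = cs.simple i by simp] at h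
  rw [this]
  simp

/-- If the parity of s_i for w were even, it would be odd for w s_i. Then s_i would be an inversion
of w s_i, so w would be shorter than w s_i. -/
theorem simple_mem_rightInvSeq {ω : List I} {i : I}
    (h : cs.IsRightDescent (cs.wordProd ω) i) : cs.simple i ∈ cs.rightInvSeq ω := by
  apply mem_rightInvSeq_of_inversionParity_ne_zero
  intro h0
  have h1 := inversionParity_mul_simple cs (cs.wordProd ω) i
  rw [h0, zero_add] at h1
  obtain ⟨ω', hred, hω'⟩ := cs.exists_isReduced (cs.wordProd ω * cs.simple i)
  rw [hω'] at h1
  have hmem := mem_rightInvSeq_of_inversionParity_ne_zero cs (h1 ▸ one_ne_zero)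
  have := (cs.isRightInversion_of_mem_rightInvSeq hred hmem).2
  rw [← hω', simple_mul_simple_cancel_right] at this
  exact lt_asymm h this

/-- The exchange condition. -/
theorem exchange {ω : List I} {i : I} (h : cs.IsRightDescent (cs.wordProd ω) i) :
    ∃ k < ω.length, cs.wordProd ω * cs.simple i = cs.wordProd (ω.eraseIdx k) := by
  obtain ⟨k, hk, e⟩ := List.getElem_of_mem (simple_mem_rightInvSeq cs h)
  refine ⟨k, by simpa using hk, ?_⟩
  rw [← cs.wordProd_mul_getD_rightInvSeq ω k, ← e, List.getD_eq_getElem _ _ hk]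

/-- Entries that occur once have odd parity, so all of them occur in the inversion sequence of any
reduced word of the same element. That word is therefore no shorter. -/
theorem isReduced_of_nodup_rightInvSeq {ω : List I} (h : (cs.rightInvSeq ω).Nodup) :
    cs.IsReduced ω := by
  classical
  obtain ⟨ω', hred, hω'⟩ := cs.exists_isReduced (cs.wordProd ω)
  have hsub : cs.rightInvSeq ω ⊆ cs.rightInvSeq ω' := by
    intro t ht
    apply mem_rightInvSeq_of_inversionParity_ne_zero
    rw [← hω', inversionParity_wordProd, List.count_eq_one_of_mem h ht]
    simp
  have hle := (h.subperm hsub).length_le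
  rw [length_rightInvSeq, length_rightInvSeq] at hle
  have : cs.length (cs.wordProd ω) = ω'.length := by rw [hω', hred.eq]
  exact le_antisymm (cs.length_wordProd_le ω) (this ▸ hle)

/-- An exchange for a product: a right descent of `u * v` that is not a right descent of `v`
removes a letter from `u`. -/
theorem exists_mul_simple_eq_of_isRightDescent_mul {u v : W} {i : I}
    (h : cs.IsRightDescent (u * v) i) (hv : ¬ cs.IsRightDescent v i) :
    ∃ u', cs.length u' < cs.length u ∧ u * v * cs.simple i = u' * v := by
  obtain ⟨ω, hω, rfl⟩ := cs.exists_isReduced u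
  obtain ⟨ω', hω', rfl⟩ := cs.exists_isReduced v
  rw [← wordProd_append] at h
  obtain ⟨k, hk, e⟩ := exchange cs h
  rw [wordProd_append] at e
  by_cases hlt : k < ω.length
  · rw [List.eraseIdx_append_of_lt_length hlt, wordProd_append] at e
    refine ⟨_, ?_, e⟩
    rw [hω.eq]
    refine lt_of_le_of_lt (cs.length_wordProd_le _) ?_
    rw [List.length_eraseIdx_of_lt hlt]
    omega
  · exfalso
    apply hv
    rw [List.eraseIdx_append_of_length_le (not_lt.1 hlt), wordProd_append, mul_assoc] at e
    rw [IsRightDescent, mul_left_cancel e, hω'.eq]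
    refine lt_of_le_of_lt (cs.length_wordProd_le _) ?_
    rw [List.length_append] at hk
    rw [List.length_eraseIdx_of_lt (by omega)]
    omega

end Exchange

/-! ### Parabolic subgroups, longest elements and the prefix order. -/

section Parabolic

open CoxeterSystem

variable {I : Type*} {Γ : CoxeterMatrix I}

local notation "ℓ" => CoxeterSystem.length (CoxeterMatrix.toCoxeterSystem Γ)
local notation "σ" => CoxeterSystem.simple (CoxeterMatrix.toCoxeterSystem Γ)
local notation "IsRD" => CoxeterSystem.IsRightDescent (CoxeterMatrix.toCoxeterSystem Γ)
local notation "IsLD" => CoxeterSystem.IsLeftDescent (CoxeterMatrix.toCoxeterSystem Γ)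

theorem simple_mem_parabolic {J : Set I} {j : I} (hj : j ∈ J) : σ j ∈ parabolic Γ J :=
  Subgroup.subset_closure ⟨j, hj, rfl⟩

theorem parabolic_mono {J K : Set I} (h : J ⊆ K) : parabolic Γ J ≤ parabolic Γ K :=
  Subgroup.closure_mono (Set.image_mono h)

theorem parabolic_induction {J : Set I} {p : ∀ v : Γ.Group, v ∈ parabolic Γ J → Prop}
    (one : p 1 (one_mem _))
    (mul : ∀ (v : Γ.Group) (hv : v ∈ parabolic Γ J) (j : I) (hj : j ∈ J), p v hv →
      p (v * σ j) (mul_mem hv (simple_mem_parabolic hj))) {v : Γ.Group}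
    (hv : v ∈ parabolic Γ J) : p v hv := by
  induction hv using Subgroup.closure_induction_right with
  | one => exact one
  | mul_right x hx y hy ih =>
    obtain ⟨j, hj, rfl⟩ := hy
    exact mul x hx j hj ih
  | mul_inv_cancel x hx y hy ih =>
    obtain ⟨j, hj, rfl⟩ := hy
    have e : (Γ.simple j)⁻¹ = σ j := Γ.toCoxeterSystem.inv_simple j
    simp only [e]
    exact mul x hx j hj ih

theorem exists_word_of_mem_parabolic {J : Set I} {v : Γ.Group} (hv : v ∈ parabolic Γ J) :
    ∃ ω : List I, (∀ j ∈ ω, j ∈ J) ∧ Γ.toCoxeterSystem.wordProd ω = v := by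
  induction hv using parabolic_induction with
  | one => exact ⟨[], by simp⟩
  | mul v hv j hj ih =>
    obtain ⟨ω, h, rfl⟩ := ih
    refine ⟨ω.concat j, ?_, wordProd_concat _ _ _⟩
    simpa [or_imp, forall_and] using ⟨h, hj⟩

/-- Either the last letter is a descent, or the exchange condition replaces the word by a shorter
one with letters still in J. -/
theorem exists_isRightDescent_wordProd {J : Set I} (ω : List I) (hω : ∀ j ∈ ω, j ∈ J)
    (h1 : Γ.toCoxeterSystem.wordProd ω ≠ 1) :
    ∃ j ∈ J, IsRD (Γ.toCoxeterSystem.wordProd ω) j := by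
  induction hn : ω.length using Nat.strong_induction_on generalizing ω with
  | _ n ih =>
    obtain rfl | ⟨ω', j, rfl⟩ := List.eq_nil_or_concat ω
    · simp at h1
    by_cases hd : IsRD (Γ.toCoxeterSystem.wordProd (ω'.concat j)) j
    · exact ⟨j, hω j (by simp), hd⟩
    rw [wordProd_concat] at hd h1 ⊢
    rw [← isRightDescent_iff_not_isRightDescent_mul] at hd
    obtain ⟨k, hk, e⟩ := exchange _ hd
    rw [e] at h1 ⊢
    refine ih _ ?_ _ (fun i hi => hω i ?_) h1 rfl
    · rw [List.length_eraseIdx_of_lt hk, ← hn]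
      simp
    · simpa using Or.inl (List.mem_of_mem_eraseIdx hi)

theorem exists_isRightDescent_of_mem_parabolic {J : Set I} {v : Γ.Group}
    (hv : v ∈ parabolic Γ J) (h1 : v ≠ 1) : ∃ j ∈ J, IsRD v j := by
  obtain ⟨ω, hω, rfl⟩ := exists_word_of_mem_parabolic hv
  exact exists_isRightDescent_wordProd ω hω h1

theorem exists_isLeftDescent_of_mem_parabolic {J : Set I} {v : Γ.Group}
    (hv : v ∈ parabolic Γ J) (h1 : v ≠ 1) : ∃ j ∈ J, IsLD v j := by
  obtain ⟨j, hj, h⟩ := exists_isRightDescent_of_mem_parabolic (inv_mem hv) (inv_ne_one.2 h1)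
  exact ⟨j, hj, (isRightDescent_inv_iff _).1 h⟩

theorem length_mul_of_forall_le {J : Set I} {w v : Γ.Group}
    (hw : ∀ u ∈ parabolic Γ J, ℓ w ≤ ℓ (w * u)) (hv : v ∈ parabolic Γ J) :
    ℓ (w * v) = ℓ w + ℓ v := by
  induction hv using parabolic_induction with
  | one => simp
  | mul v hv j hj ih =>
    have hle := Γ.toCoxeterSystem.length_mul_le w (v * σ j)
    rw [← mul_assoc] at hle ⊢
    by_cases hd : IsRD v j
    · have := (isRightDescent_iff _).1 hd
      rcases Γ.toCoxeterSystem.length_mul_simple (w * v) j with h | h <;> omega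
    · have h1 := (not_isRightDescent_iff _).1 hd
      by_cases hd' : IsRD (w * v) j
      · exfalso
        -- The exchanged letter comes from w, and u' = w (v s_j v⁻¹) is a shorter element of the
        -- coset w W_J.
        obtain ⟨u', hu', e⟩ := exists_mul_simple_eq_of_isRightDescent_mul _ hd' hd
        have := hw (v * σ j * v⁻¹) (mul_mem (mul_mem hv (simple_mem_parabolic hj)) (inv_mem hv))
        rw [← mul_assoc, ← mul_assoc, e, mul_inv_cancel_right] at this
        omega
      · have h2 := (not_isRightDescent_iff _).1 hd'
        omega

/-- Having no right descent in J makes w minimal in w W_J: if the minimum were w u with u ≠ 1, a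
right descent of u⁻¹ in J would be one of w. -/
theorem length_mul_of_ascents {J : Set I} {w v : Γ.Group}
    (hw : ∀ j ∈ J, ¬ IsRD w j) (hv : v ∈ parabolic Γ J) :
    ℓ (w * v) = ℓ w + ℓ v := by
  obtain ⟨u, hu, hmin⟩ : ∃ u ∈ parabolic Γ J, ∀ x ∈ parabolic Γ J, ℓ (w * u) ≤ ℓ (w * x) := by
    have hne : (parabolic Γ J : Set Γ.Group).Nonempty := ⟨1, one_mem _⟩
    refine ⟨Function.argminOn (fun u => ℓ (w * u)) _ hne,
      Function.argminOn_mem _ _ _,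
      fun x hx => Function.argminOn_le (fun u => ℓ (w * u)) _ hx⟩
  have hmin' : ∀ x ∈ parabolic Γ J, ℓ (w * u) ≤ ℓ (w * u * x) := fun x hx => by
    rw [mul_assoc]
    exact hmin _ (mul_mem hu hx)
  obtain rfl : u = 1 := by
    by_contra h1
    obtain ⟨j, hj, hd⟩ := exists_isRightDescent_of_mem_parabolic (inv_mem hu) (inv_ne_one.2 h1)
    apply hw j hj
    have e1 := length_mul_of_forall_le hmin' (inv_mem hu)
    have e2 := length_mul_of_forall_le hmin' (mul_mem (inv_mem hu) (simple_mem_parabolic hj))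
    rw [mul_inv_cancel_right] at e1
    rw [← mul_assoc, mul_inv_cancel_right] at e2
    rw [CoxeterSystem.IsRightDescent] at hd ⊢
    omega
  rw [mul_one] at hmin'
  exact length_mul_of_forall_le hmin' hv

/-- Elements of W_J are suffixes of w, by induction on length. If u = u' s_j is longer than the
suffix u', exchanging the descent j of w must delete a letter in front of u', and so u is a suffix
as well. -/
theorem length_mul_inv_add_of_descents {J : Set I} {w u : Γ.Group}
    (hw : ∀ j ∈ J, IsRD w j) (hu : u ∈ parabolic Γ J) :
    ℓ (w * u⁻¹) + ℓ u = ℓ w := by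
  induction hn : ℓ u using Nat.strong_induction_on generalizing u with
  | _ n ih =>
    by_cases h1 : u = 1
    · subst h1
      simp [← hn]
    obtain ⟨j, hj, hd⟩ := exists_isRightDescent_of_mem_parabolic hu h1
    have hl := (isRightDescent_iff _).1 hd
    have e1 := ih _ (by omega) (mul_mem hu (simple_mem_parabolic hj)) rfl
    have hd' : ¬ IsRD (u * σ j) j := (isRightDescent_iff_not_isRightDescent_mul _).1 hd
    have hwd : IsRD (w * (u * σ j)⁻¹ * (u * σ j)) j := by
      rw [inv_mul_cancel_right]
      exact hw j hj
    obtain ⟨x, hx, e⟩ := exists_mul_simple_eq_of_isRightDescent_mul _ hwd hd'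
    have e' : x = w * u⁻¹ := by
      rw [← mul_left_inj (u * σ j), ← e]
      simp [-CoxeterMatrix.toCoxeterSystem_simple, mul_assoc]
    rw [e'] at hx
    have := Γ.toCoxeterSystem.length_mul_le (w * u⁻¹) u
    rw [inv_mul_cancel_right] at this
    omega

/-- The reflections s_j with j ∈ J lie in one finite inversion sequence, and elements of W_J, being
suffixes of w, have bounded length. -/
theorem isSpherical_of_right_descents {J : Set I} {w : Γ.Group} (hw : ∀ j ∈ J, IsRD w j) :
    IsSpherical Γ J := by
  obtain ⟨ω, -, rfl⟩ := Γ.toCoxeterSystem.exists_isReduced w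
  have hfin : (σ '' J).Finite := by
    refine (List.finite_toSet (Γ.toCoxeterSystem.rightInvSeq ω)).subset ?_
    rintro _ ⟨j, hj, rfl⟩
    exact simple_mem_rightInvSeq _ (hw j hj)
  have hn : ∀ n, {u | u ∈ parabolic Γ J ∧ ℓ u ≤ n}.Finite := by
    intro n
    induction n with
    | zero =>
      refine (Set.finite_singleton (1 : Γ.Group)).subset ?_
      rintro u ⟨-, hu⟩
      exact (length_eq_zero_iff _).1 (Nat.le_zero.1 hu)
    | succ n ih =>
      refine ((Set.finite_singleton (1 : Γ.Group)).union (ih.image2 (· * ·) hfin)).subset ?_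
      rintro u ⟨hu, hl⟩
      by_cases h1 : u = 1
      · exact Or.inl h1
      obtain ⟨j, hj, hd⟩ := exists_isRightDescent_of_mem_parabolic hu h1
      have := (isRightDescent_iff _).1 hd
      exact Or.inr ⟨u * σ j, ⟨mul_mem hu (simple_mem_parabolic hj), by omega⟩, σ j,
        ⟨j, hj, rfl⟩, simple_mul_simple_cancel_right _ _⟩
  refine (hn (ℓ (Γ.toCoxeterSystem.wordProd ω))).subset fun u hu => ⟨hu, ?_⟩
  have := length_mul_inv_add_of_descents hw hu
  omega

/-- `u` is a prefix of `w` (the right weak order). -/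
def IsPrefix (u w : Γ.Group) : Prop := ℓ u + ℓ (u⁻¹ * w) = ℓ w

theorem isPrefix_of_left_descents {J : Set I} {w u : Γ.Group}
    (hw : ∀ j ∈ J, IsLD w j) (hu : u ∈ parabolic Γ J) : IsPrefix u w := by
  have := length_mul_inv_add_of_descents (w := w⁻¹) (u := u⁻¹)
    (fun j hj => (isRightDescent_inv_iff _).2 (hw j hj)) (inv_mem hu)
  rw [← mul_inv_rev, length_inv, length_inv, length_inv] at this
  rw [IsPrefix, add_comm, this]

theorem isSpherical_of_left_descents {J : Set I} {w : Γ.Group} (hw : ∀ j ∈ J, IsLD w j) :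
    IsSpherical Γ J :=
  isSpherical_of_right_descents (w := w⁻¹) fun j hj => (isRightDescent_inv_iff _).2 (hw j hj)

namespace IsLongest

variable {J : Set I} {r : Γ.Group}

theorem inv (h : IsLongest Γ J r) : IsLongest Γ J r⁻¹ :=
  ⟨inv_mem h.1, fun v hv => by rw [length_inv]; exact h.2 v hv⟩

theorem isRightDescent (h : IsLongest Γ J r) {j : I} (hj : j ∈ J) : IsRD r j := by
  by_contra hd
  have h1 := (not_isRightDescent_iff _).1 hd
  have h2 := h.2 _ (mul_mem h.1 (simple_mem_parabolic hj))
  omega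

theorem isLeftDescent (h : IsLongest Γ J r) {j : I} (hj : j ∈ J) : IsLD r j :=
  (isRightDescent_inv_iff _).1 (h.inv.isRightDescent hj)

theorem isPrefix (h : IsLongest Γ J r) {u : Γ.Group} (hu : u ∈ parabolic Γ J) : IsPrefix u r :=
  isPrefix_of_left_descents (fun _ hj => h.isLeftDescent hj) hu

theorem eq_of_left_descents {w : Γ.Group} (h : IsLongest Γ J r) (hw : w ∈ parabolic Γ J)
    (hd : ∀ j ∈ J, IsLD w j) : w = r := by
  have h1 : IsPrefix r w := isPrefix_of_left_descents hd h.1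
  have h2 := h.2 w hw
  rw [IsPrefix] at h1
  have : ℓ (r⁻¹ * w) = 0 := by omega
  rw [length_eq_zero_iff, inv_mul_eq_one] at this
  exact this.symm

theorem unique {r' : Γ.Group} (h : IsLongest Γ J r) (h' : IsLongest Γ J r') : r = r' :=
  h'.eq_of_left_descents h.1 fun _ hj => h.isLeftDescent hj

theorem mul_self (h : IsLongest Γ J r) : r * r = 1 := by
  rw [mul_eq_one_iff_eq_inv]
  exact h.unique h.inv

end IsLongest

theorem isPrefix_refl (w : Γ.Group) : IsPrefix w w := by simp [IsPrefix]

theorem one_isPrefix (w : Γ.Group) : IsPrefix 1 w := by simp [IsPrefix]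

theorem IsPrefix.trans {u v w : Γ.Group} (h : IsPrefix u v) (h' : IsPrefix v w) :
    IsPrefix u w := by
  have h1 := Γ.toCoxeterSystem.length_mul_le (u⁻¹ * v) (v⁻¹ * w)
  have h2 := Γ.toCoxeterSystem.length_mul_le u (u⁻¹ * w)
  rw [mul_assoc, mul_inv_cancel_left] at h1
  rw [mul_inv_cancel_left] at h2
  rw [IsPrefix] at *
  omega

theorem IsPrefix.antisymm {u w : Γ.Group} (h : IsPrefix u w) (h' : IsPrefix w u) : u = w := by
  rw [IsPrefix] at *
  have : ℓ (u⁻¹ * w) = 0 := by omega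
  rwa [length_eq_zero_iff, inv_mul_eq_one] at this

theorem isPrefix_mul {u v : Γ.Group} (h : ℓ (u * v) = ℓ u + ℓ v) : IsPrefix u (u * v) := by
  simp [IsPrefix, h]

/-- Length additivity passes to prefixes of the second factor. -/
theorem length_mul_of_isPrefix {v p w : Γ.Group} (hw : ℓ (v * w) = ℓ v + ℓ w)
    (hp : IsPrefix p w) : ℓ (v * p) = ℓ v + ℓ p := by
  have h1 := Γ.toCoxeterSystem.length_mul_le v p
  have h2 := Γ.toCoxeterSystem.length_mul_le (v * p) (p⁻¹ * w)
  rw [mul_assoc, mul_inv_cancel_left] at h2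
  rw [IsPrefix] at hp
  omega

theorem isPrefix_mul_left_iff {v p w : Γ.Group} (hw : ℓ (v * w) = ℓ v + ℓ w)
    (hp : ℓ (v * p) = ℓ v + ℓ p) : IsPrefix (v * p) (v * w) ↔ IsPrefix p w := by
  rw [IsPrefix, IsPrefix, hw, hp, mul_inv_rev, mul_assoc, inv_mul_cancel_left]
  omega

/-- Among the prefixes `x` of `w` such that lengths add in `v * x`, those that extend a given one
have a greatest element. -/
theorem exists_greatest_prefix_above (v w : Γ.Group) (n : ℕ) (x : Γ.Group) (hxw : IsPrefix x w)
    (hvx : ℓ (v * x) = ℓ v + ℓ x) (hn : ℓ w ≤ ℓ x + n) :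
    ∃ p, IsPrefix p w ∧ ℓ (v * p) = ℓ v + ℓ p ∧
      ∀ y, IsPrefix y w → ℓ (v * y) = ℓ v + ℓ y → IsPrefix x y → IsPrefix y p := by
  induction n generalizing x with
  | zero =>
    refine ⟨x, hxw, hvx, fun y hy _ hxy => ?_⟩
    rw [IsPrefix] at *
    have h0 : ℓ (x⁻¹ * w) = 0 := by omega
    rw [length_eq_zero_iff, inv_mul_eq_one] at h0
    subst h0
    omega
  | succ n ih =>
    -- a proper extension of `x` starts with a letter that can be added to `x`
    have step : ∀ y, IsPrefix y w → ℓ (v * y) = ℓ v + ℓ y → IsPrefix x y → x ≠ y →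
        ∃ i, ℓ (x * σ i) = ℓ x + 1 ∧ IsPrefix (x * σ i) y := by
      intro y hy hvy hxy hne
      obtain ⟨i, hi⟩ := Γ.toCoxeterSystem.exists_leftDescent_of_ne_one
        (w := x⁻¹ * y) (by rwa [Ne, inv_mul_eq_one])
      have hi' := (isLeftDescent_iff _).1 hi
      have h1 := Γ.toCoxeterSystem.length_mul_le (x * σ i) (σ i * (x⁻¹ * y))
      rw [mul_assoc, simple_mul_simple_cancel_left, mul_inv_cancel_left] at h1
      have h2 := Γ.toCoxeterSystem.length_mul_simple x i
      have h3 : (x * σ i)⁻¹ * y = σ i * (x⁻¹ * y) := by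
          rw [mul_inv_rev, inv_simple, mul_assoc]
      rw [IsPrefix] at hxy
      refine ⟨i, by omega, ?_⟩
      rw [IsPrefix, h3]
      omega
    by_cases hex : ∃ i, ℓ (x * σ i) = ℓ x + 1 ∧ IsPrefix (x * σ i) w ∧
        ℓ (v * (x * σ i)) = ℓ v + ℓ (x * σ i)
    · obtain ⟨i, hi, hiw, hvi⟩ := hex
      obtain ⟨p, hpw, hvp, hp⟩ := ih (x * σ i) hiw hvi (by omega)
      refine ⟨p, hpw, hvp, fun y hy hvy hxy => ?_⟩
      by_cases hne : x = y
      · subst hne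
        refine IsPrefix.trans ?_ (hp _ hiw hvi (isPrefix_refl _))
        exact isPrefix_mul (by rw [hi, length_simple])
      obtain ⟨j, hj, hjy⟩ := step y hy hvy hxy hne
      have hjw := hjy.trans hy
      have hvj := length_mul_of_isPrefix hvy hjy
      obtain ⟨q, hqw, hvq, hq⟩ := ih (x * σ j) hjw hvj (by omega)
      -- the join of the two extensions
      have hdesc : ∀ k, ℓ (x * σ k) = ℓ x + 1 → IsPrefix (x * σ k) w → IsLD (x⁻¹ * w) k := by
        intro k hk hkw
        have h3 : (x * σ k)⁻¹ * w = σ k * (x⁻¹ * w) := by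
          rw [mul_inv_rev, inv_simple, mul_assoc]
        rw [IsPrefix, h3] at hkw
        rw [IsPrefix] at hxw
        rw [CoxeterSystem.IsLeftDescent]
        omega
      have hLD : ∀ k ∈ ({i, j} : Set I), IsLD (x⁻¹ * w) k := by
        rintro k (rfl | rfl)
        exacts [hdesc _ hi hiw, hdesc _ hj hjw]
      -- Both letters are left descents of x⁻¹ w, so W_{i,j} is finite and x r is a prefix of w
      -- above both x s_i and x s_j.
      obtain ⟨r, hr⟩ := exists_isLongest (isSpherical_of_left_descents hLD)
      have hrw : IsPrefix r (x⁻¹ * w) := isPrefix_of_left_descents hLD hr.1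
      have hxasc : ∀ k ∈ ({i, j} : Set I), ¬ IsRD x k := by
        rintro k (rfl | rfl) <;> rw [not_isRightDescent_iff] <;> assumption
      have hvxasc : ∀ k ∈ ({i, j} : Set I), ¬ IsRD (v * x) k := by
        rintro k (rfl | rfl) <;> rw [not_isRightDescent_iff, mul_assoc] <;> omega
      have hxr := length_mul_of_ascents hxasc hr.1
      have hvxr := length_mul_of_ascents hvxasc hr.1
      have hzw : IsPrefix (x * r) w := by
        have h3 : (x * r)⁻¹ * w = r⁻¹ * (x⁻¹ * w) := by
          rw [mul_inv_rev, mul_assoc]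
        rw [IsPrefix, h3]
        rw [IsPrefix] at hxw hrw
        omega
      have hvz : ℓ (v * (x * r)) = ℓ v + ℓ (x * r) := by
        rw [← mul_assoc]
        omega
      have hz : ∀ k ∈ ({i, j} : Set I), ℓ (x * σ k) = ℓ x + 1 → IsPrefix (x * σ k) (x * r) := by
        intro k hk hk1
        rw [isPrefix_mul_left_iff hxr (by rw [hk1, length_simple])]
        exact hr.isPrefix (simple_mem_parabolic hk)
      -- The join x r lies below q, so q is above x s_i and hence below p; y is below q since it
      -- extends x s_j.
      have hzq := hq _ hzw hvz (hz j (by simp) hj)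
      exact (hq y hy hvy hjy).trans (hp q hqw hvq ((hz i (by simp) hi).trans hzq))
    · refine ⟨x, hxw, hvx, fun y hy hvy hxy => ?_⟩
      by_cases hne : x = y
      · subst hne
        exact isPrefix_refl _
      obtain ⟨j, hj, hjy⟩ := step y hy hvy hxy hne
      exact absurd ⟨j, hj, hjy.trans hy, length_mul_of_isPrefix hvy hjy⟩ hex

theorem exists_greatest_prefix (v w : Γ.Group) :
    ∃ p, IsPrefix p w ∧ ℓ (v * p) = ℓ v + ℓ p ∧
      ∀ y, IsPrefix y w → ℓ (v * y) = ℓ v + ℓ y → IsPrefix y p := by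
  obtain ⟨p, hp, hvp, h⟩ := exists_greatest_prefix_above v w (ℓ w) 1 (one_isPrefix w) (by simp)
    (by simp)
  exact ⟨p, hp, hvp, fun y hy hvy => h y hy hvy (one_isPrefix y)⟩

end Parabolic

/-! ### Alternating products of involutions. -/

section AlternatingWords

/-- The inverse of an alternating product of involutions is the reversed word, so the quotient of
the two products alternates over 2k letters. Braid relations thus become torsion relations. -/
theorem altProd_eq_pow_mul_altProd {N : Type*} [Group N] {u v : N} (hu : u * u = 1)
    (hv : v * v = 1) (k : ℕ) : altProd k u v = (u * v) ^ k * altProd k v u := by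
  induction k generalizing u v with
  | zero => simp [altProd]
  | succ k ih =>
    rw [altProd, altProd, ih hv hu, pow_succ, ← mul_assoc, ← mul_assoc, mul_assoc _ (u * v) v,
      mul_assoc u v v, hv, mul_one]
    rw [mul_pow_mul]

theorem altProd_eq_altProd_swap_iff {N : Type*} [Group N] {u v : N} (hu : u * u = 1)
    (hv : v * v = 1) (k : ℕ) : altProd k u v = altProd k v u ↔ (u * v) ^ k = 1 := by
  rw [altProd_eq_pow_mul_altProd hu hv, mul_eq_right]

variable {I : Type*}

/-- The word of length `n` that alternates between `i` and `j`, starting with `i`. -/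
def altList : ℕ → I → I → List I
  | 0, _, _ => []
  | n + 1, i, j => i :: altList n j i

theorem prod_map_altList {N : Type*} [Monoid N] (f : I → N) (n : ℕ) (i j : I) :
    ((altList n i j).map f).prod = altProd n (f i) (f j) := by
  induction n generalizing i j with
  | zero => rfl
  | succ n ih => simp [altList, altProd, ih]

theorem mem_of_mem_altList {n : ℕ} {i j k : I} (h : k ∈ altList n i j) : k = i ∨ k = j := by
  induction n generalizing i j with
  | zero => simp [altList] at h
  | succ n ih =>
    rw [altList, List.mem_cons] at h
    exact h.imp id ih |>.elim Or.inl (fun h => (h.symm))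

end AlternatingWords

/-! ### Matsumoto's theorem and simple elements of the monoid. -/

section Matsumoto

open CoxeterSystem

variable {I : Type*} {Γ : CoxeterMatrix I}

local notation "ℓ" => CoxeterSystem.length (CoxeterMatrix.toCoxeterSystem Γ)
local notation "σ" => CoxeterSystem.simple (CoxeterMatrix.toCoxeterSystem Γ)
local notation "π" => CoxeterSystem.wordProd (CoxeterMatrix.toCoxeterSystem Γ)
local notation "IsLD" => CoxeterSystem.IsLeftDescent (CoxeterMatrix.toCoxeterSystem Γ)

theorem wordProd_altList (n : ℕ) (i j : I) : π (altList n i j) = altProd n (σ i) (σ j) :=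
  prod_map_altList _ n i j

theorem leftInvSeq_altList (n : ℕ) (i j : I) :
    Γ.toCoxeterSystem.leftInvSeq (altList n i j) =
      (List.range n).map fun k => σ i * (σ j * σ i) ^ k := by
  induction n generalizing i j with
  | zero => rfl
  | succ n ih =>
    rw [altList, leftInvSeq, ih, List.range_succ_eq_map, List.map_cons, List.map_map, List.map_map,
      pow_zero, mul_one]
    congr 1
    apply List.map_congr_left
    intro k _
    rw [Function.comp_apply, Function.comp_apply, MulAut.conj_apply, inv_simple,
      Nat.succ_eq_add_one, pow_succ', mul_assoc, mul_assoc, mul_assoc]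
    rw [mul_pow_mul]

/-- The inversions are s_i (s_j s_i)^k for k < m, and they are distinct because s_j s_i has order
exactly m. For m = ∞ the word is empty. -/
theorem isReduced_altList (i j : I) : Γ.toCoxeterSystem.IsReduced (altList (Γ i j) i j) := by
  rw [← isReduced_reverse_iff]
  apply isReduced_of_nodup_rightInvSeq
  rw [rightInvSeq_reverse, List.nodup_reverse, leftInvSeq_altList]
  refine List.Nodup.map_on ?_ List.nodup_range
  intro a ha b hb h
  have ho := orderOf_simple_mul_simple Γ j i
  rw [Γ.symmetric j i] at ho
  rw [List.mem_range, ← ho] at ha hb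
  exact pow_injOn_Iio_orderOf ha hb (mul_left_cancel h)

theorem wordProd_altList_swap (i j : I) :
    π (altList (Γ i j) i j) = π (altList (Γ i j) j i) := by
  rw [wordProd_altList, wordProd_altList, altProd_eq_altProd_swap_iff
    (simple_mul_simple_self _ i) (simple_mul_simple_self _ j)]
  exact simple_mul_simple_pow _ i j

theorem orderOf_ne_zero_of_isSpherical {J : Set I} (h : IsSpherical Γ J) {u : Γ.Group}
    (hu : u ∈ parabolic Γ J) : orderOf u ≠ 0 := by
  have : Finite (parabolic Γ J) := h.to_subtype
  have h1 := orderOf_pos (⟨u, hu⟩ : parabolic Γ J)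
  rw [Subgroup.orderOf_mk] at h1
  exact h1.ne'

theorem isReduced_cons {i : I} {ω : List I} (h : Γ.toCoxeterSystem.IsReduced (i :: ω)) :
    Γ.toCoxeterSystem.IsReduced ω := h.drop 1

theorem isLeftDescent_of_isReduced_cons {i : I} {ω : List I}
    (h : Γ.toCoxeterSystem.IsReduced (i :: ω)) : IsLD (π (i :: ω)) i := by
  rw [CoxeterSystem.IsLeftDescent, h.eq, wordProd_cons, simple_mul_simple_cancel_left,
    (isReduced_cons h).eq]
  simp

theorem isReduced_append {ω ω' : List I} (h : Γ.toCoxeterSystem.IsReduced ω)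
    (h' : Γ.toCoxeterSystem.IsReduced ω') (hl : ℓ (π ω * π ω') = ℓ (π ω) + ℓ (π ω')) :
    Γ.toCoxeterSystem.IsReduced (ω ++ ω') := by
  rw [CoxeterSystem.IsReduced, wordProd_append, hl, h.eq, h'.eq, List.length_append]

/-- **Matsumoto's theorem**: two reduced words of the same element of the Coxeter group represent
the same element of the Artin-Tits monoid. -/
theorem prod_map_gen_eq_of_isReduced {ω ω' : List I} (hω : Γ.toCoxeterSystem.IsReduced ω)
    (hω' : Γ.toCoxeterSystem.IsReduced ω') (h : π ω = π ω') :
    (ω.map (PosMonoid.gen Γ)).prod = (ω'.map (PosMonoid.gen Γ)).prod := by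
  induction hn : ω.length generalizing ω ω' with
  | zero =>
    have hl := hω'.eq
    rw [← h, hω.eq, hn] at hl
    rw [List.length_eq_zero_iff.1 hn, List.length_eq_zero_iff.1 hl.symm]
  | succ n ih =>
    have hl := hω'.eq
    rw [← h, hω.eq, hn] at hl
    obtain ⟨i, u, rfl⟩ := List.exists_cons_of_length_eq_add_one hn
    obtain ⟨j, u', rfl⟩ := List.exists_cons_of_length_eq_add_one hl.symm
    rw [List.length_cons, Nat.add_right_cancel_iff] at hn hl
    by_cases hij : i = j
    · subst hij
      rw [wordProd_cons, wordProd_cons] at h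
      rw [List.map_cons, List.map_cons, List.prod_cons, List.prod_cons,
        ih (isReduced_cons hω) (isReduced_cons hω') (mul_left_cancel h) hn]
    have hLD : ∀ k ∈ ({i, j} : Set I), IsLD (π (i :: u)) k := by
      rintro k (rfl | rfl)
      · exact isLeftDescent_of_isReduced_cons hω
      · rw [h]
        exact isLeftDescent_of_isReduced_cons hω'
    -- Two distinct first letters are both left descents, so m is finite and w starts with the
    -- alternating word of length m, in either order. Induction compares each given word with the
    -- one sharing its first letter; a single braid relation connects these two.
    have hm : Γ i j ≠ 0 := by
      rw [← orderOf_simple_mul_simple]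
      exact orderOf_ne_zero_of_isSpherical (isSpherical_of_left_descents hLD)
        (mul_mem (simple_mem_parabolic (by simp)) (simple_mem_parabolic (by simp)))
    have hmem : π (altList (Γ i j) i j) ∈ parabolic Γ {i, j} := by
      refine Subgroup.list_prod_mem _ fun x hx => ?_
      obtain ⟨k, hk, rfl⟩ := List.mem_map.1 hx
      exact simple_mem_parabolic (by simpa using mem_of_mem_altList hk)
    have hpre := isPrefix_of_left_descents hLD hmem
    obtain ⟨τ, hτ, e⟩ := Γ.toCoxeterSystem.exists_isReduced
      ((π (altList (Γ i j) i j))⁻¹ * π (i :: u))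
    have hw : π (altList (Γ i j) i j) * π τ = π (i :: u) := by rw [← e, mul_inv_cancel_left]
    have hlen : ℓ (π (altList (Γ i j) i j) * π τ) = ℓ (π (altList (Γ i j) i j)) + ℓ (π τ) := by
      rw [hw, ← e]
      exact hpre.symm
    have hred := isReduced_append (isReduced_altList i j) hτ hlen
    have hred' : Γ.toCoxeterSystem.IsReduced (altList (Γ i j) j i ++ τ) := by
      refine isReduced_append ?_ hτ ?_
      · rw [Γ.symmetric i j]
        exact isReduced_altList j i
      · rw [← wordProd_altList_swap, hlen]
    have e1 : π (altList (Γ i j) i j ++ τ) = π (i :: u) := by rw [wordProd_append, hw]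
    have e2 : π (altList (Γ i j) j i ++ τ) = π (j :: u') := by
      rw [wordProd_append, ← wordProd_altList_swap, hw, h]
    have p1 : ((altList (Γ i j) i j ++ τ).map (PosMonoid.gen Γ)).prod =
        ((i :: u).map (PosMonoid.gen Γ)).prod := by
      obtain ⟨m, hm'⟩ := Nat.exists_eq_succ_of_ne_zero hm
      rw [hm', Nat.succ_eq_add_one, altList, List.cons_append] at e1 hred ⊢
      rw [wordProd_cons, wordProd_cons] at e1
      rw [List.map_cons, List.map_cons, List.prod_cons, List.prod_cons,
        ih (isReduced_cons hω) (isReduced_cons hred) (mul_left_cancel e1).symm hn]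
    have p2 : ((altList (Γ i j) j i ++ τ).map (PosMonoid.gen Γ)).prod =
        ((j :: u').map (PosMonoid.gen Γ)).prod := by
      obtain ⟨m, hm'⟩ := Nat.exists_eq_succ_of_ne_zero hm
      rw [hm', Nat.succ_eq_add_one, altList, List.cons_append] at e2 hred' ⊢
      rw [wordProd_cons, wordProd_cons] at e2
      rw [List.map_cons, List.map_cons, List.prod_cons, List.prod_cons,
        ih (isReduced_cons hω') (isReduced_cons hred') (mul_left_cancel e2).symm hl.symm]
    rw [← p1, ← p2, List.map_append, List.map_append, List.prod_append, List.prod_append,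
      prod_map_altList, prod_map_altList, PosMonoid.gen_braid Γ i j hm]

theorem simpleElt_wordProd {ω : List I} (h : Γ.toCoxeterSystem.IsReduced ω) :
    simpleElt Γ (π ω) = (ω.map (PosMonoid.gen Γ)).prod := by
  obtain ⟨h1, h2⟩ := (exists_reduced Γ (π ω)).choose_spec
  refine prod_map_gen_eq_of_isReduced ?_ h h2
  rw [CoxeterSystem.IsReduced, h2, h1]

theorem simpleElt_one : simpleElt Γ 1 = 1 := by
  have h : Γ.toCoxeterSystem.IsReduced [] := by simp [CoxeterSystem.IsReduced]
  simpa using simpleElt_wordProd h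

theorem simpleElt_simple (i : I) : simpleElt Γ (σ i) = PosMonoid.gen Γ i := by
  have h : Γ.toCoxeterSystem.IsReduced [i] := by
    rw [CoxeterSystem.IsReduced, wordProd_singleton, length_simple]
    rfl
  have := simpleElt_wordProd h
  rwa [wordProd_singleton, List.map_singleton, List.prod_singleton] at this

theorem simpleElt_mul {u v : Γ.Group} (h : ℓ (u * v) = ℓ u + ℓ v) :
    simpleElt Γ (u * v) = simpleElt Γ u * simpleElt Γ v := by
  obtain ⟨ω, hω, rfl⟩ := Γ.toCoxeterSystem.exists_isReduced u
  obtain ⟨ω', hω', rfl⟩ := Γ.toCoxeterSystem.exists_isReduced v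
  rw [simpleElt_wordProd hω, simpleElt_wordProd hω', ← wordProd_append,
    simpleElt_wordProd (isReduced_append hω hω' h), List.map_append, List.prod_append]

theorem IsPrefix.simpleElt_eq {u w : Γ.Group} (h : IsPrefix u w) :
    simpleElt Γ w = simpleElt Γ u * simpleElt Γ (u⁻¹ * w) := by
  rw [← simpleElt_mul, mul_inv_cancel_left]
  rw [mul_inv_cancel_left, h]

theorem IsPrefix.simpleElt_dvd {u w : Γ.Group} (h : IsPrefix u w) :
    simpleElt Γ u ∣ simpleElt Γ w := ⟨_, h.simpleElt_eq⟩

end Matsumoto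

/-! ### The normal form of B⁺, cancellation and common multiples. -/

section NormalForm

open CoxeterSystem

variable {I : Type*} {Γ : CoxeterMatrix I}

local notation "ℓ" => CoxeterSystem.length (CoxeterMatrix.toCoxeterSystem Γ)
local notation "σ" => CoxeterSystem.simple (CoxeterMatrix.toCoxeterSystem Γ)
local notation "π" => CoxeterSystem.wordProd (CoxeterMatrix.toCoxeterSystem Γ)
local notation "IsLD" => CoxeterSystem.IsLeftDescent (CoxeterMatrix.toCoxeterSystem Γ)

/-- The greatest prefix `p` of `w` such that lengths add in `v * p`. -/
noncomputable def greatestPrefix (v w : Γ.Group) : Γ.Group := (exists_greatest_prefix v w).choose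

theorem greatestPrefix_isPrefix (v w : Γ.Group) : IsPrefix (greatestPrefix v w) w :=
  (exists_greatest_prefix v w).choose_spec.1

theorem length_mul_greatestPrefix (v w : Γ.Group) :
    ℓ (v * greatestPrefix v w) = ℓ v + ℓ (greatestPrefix v w) :=
  (exists_greatest_prefix v w).choose_spec.2.1

theorem isPrefix_greatestPrefix {v w y : Γ.Group} (h : IsPrefix y w)
    (hl : ℓ (v * y) = ℓ v + ℓ y) : IsPrefix y (greatestPrefix v w) :=
  (exists_greatest_prefix v w).choose_spec.2.2 y h hl

theorem greatestPrefix_one_left (w : Γ.Group) : greatestPrefix 1 w = w :=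
  (greatestPrefix_isPrefix 1 w).antisymm (isPrefix_greatestPrefix (isPrefix_refl w) (by simp))

/-- Absorbing into v' and then into v is absorbing into v v' at once, which makes `absorb`
multiplicative on reduced products. Each side is a prefix of the other by the maximality defining
the latter. -/
theorem greatestPrefix_mul {v v' w : Γ.Group} (h : ℓ (v * v') = ℓ v + ℓ v') :
    greatestPrefix v (v' * greatestPrefix v' w) = v' * greatestPrefix (v * v') w := by
  have hq := length_mul_greatestPrefix (v * v') w
  have hqp := greatestPrefix_isPrefix (v * v') w
  have hp := length_mul_greatestPrefix v' w
  have hpp := greatestPrefix_isPrefix v' w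
  have hg := length_mul_greatestPrefix v (v' * greatestPrefix v' w)
  have hgp := greatestPrefix_isPrefix v (v' * greatestPrefix v' w)
  have h1 : ℓ (v' * greatestPrefix (v * v') w) = ℓ v' + ℓ (greatestPrefix (v * v') w) := by
    have := Γ.toCoxeterSystem.length_mul_le v (v' * greatestPrefix (v * v') w)
    have := Γ.toCoxeterSystem.length_mul_le v' (greatestPrefix (v * v') w)
    rw [← mul_assoc] at *
    omega
  apply IsPrefix.antisymm
  · have hv' : IsPrefix v' (greatestPrefix v (v' * greatestPrefix v' w)) :=
      isPrefix_greatestPrefix (isPrefix_mul hp) h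
    obtain ⟨c, hc⟩ : ∃ c, greatestPrefix v (v' * greatestPrefix v' w) = v' * c :=
      ⟨_, (mul_inv_cancel_left v' _).symm⟩
    rw [hc] at hg hgp hv' ⊢
    have hvc : ℓ (v' * c) = ℓ v' + ℓ c := by
      rw [IsPrefix, inv_mul_cancel_left] at hv'
      exact hv'.symm
    rw [isPrefix_mul_left_iff h1 hvc]
    apply isPrefix_greatestPrefix
    · exact ((isPrefix_mul_left_iff hp hvc).1 hgp).trans hpp
    · rw [mul_assoc]
      omega
  · apply isPrefix_greatestPrefix
    · rw [isPrefix_mul_left_iff hp h1]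
      exact isPrefix_greatestPrefix hqp h1
    · rw [← mul_assoc]
      omega

/-- The action of an element `v` of the Coxeter group on pairs `(w, x)`, thought of as the product
`w x` of a simple element and an element of the Artin-Tits monoid: move to the left factor the
greatest part of `w` that can be absorbed by `v`. -/
noncomputable def absorb (v : Γ.Group) : Function.End (Γ.Group × PosMonoid Γ) :=
  fun z => (v * greatestPrefix v z.1, simpleElt Γ ((greatestPrefix v z.1)⁻¹ * z.1) * z.2)

theorem absorb_one : absorb (1 : Γ.Group) = 1 := by
  funext z
  simp only [absorb, greatestPrefix_one_left, one_mul, inv_mul_cancel, simpleElt_one]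
  rfl

theorem absorb_mul {v v' : Γ.Group} (h : ℓ (v * v') = ℓ v + ℓ v') :
    absorb (v * v') = absorb v * absorb v' := by
  funext z
  change absorb (v * v') z = absorb v (absorb v' z)
  simp only [absorb, greatestPrefix_mul h, Prod.mk.injEq]
  refine ⟨mul_assoc _ _ _, ?_⟩
  have hp := greatestPrefix_isPrefix v' z.1
  have hqp := greatestPrefix_isPrefix (v * v') z.1
  have hpq : IsPrefix (greatestPrefix (v * v') z.1) (greatestPrefix v' z.1) := by
    refine isPrefix_greatestPrefix hqp ?_
    have h1 := length_mul_greatestPrefix (v * v') z.1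
    have := Γ.toCoxeterSystem.length_mul_le v (v' * greatestPrefix (v * v') z.1)
    have := Γ.toCoxeterSystem.length_mul_le v' (greatestPrefix (v * v') z.1)
    rw [← mul_assoc] at *
    omega
  generalize greatestPrefix (v * v') z.1 = q at *
  generalize greatestPrefix v' z.1 = p at *
  rw [← mul_assoc, ← simpleElt_mul]
  · congr 2
    group
  · have e : (v' * q)⁻¹ * (v' * p) * (p⁻¹ * z.1) = q⁻¹ * z.1 := by group
    have e' : (v' * q)⁻¹ * (v' * p) = q⁻¹ * p := by group
    rw [e, e']
    rw [IsPrefix] at *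
    omega

theorem prod_map_absorb {ω : List I} (h : Γ.toCoxeterSystem.IsReduced ω) :
    (ω.map fun i => absorb (σ i)).prod = absorb (π ω) := by
  induction ω with
  | nil => simp [absorb_one]
  | cons i ω ih =>
    have h' := isReduced_cons h
    rw [List.map_cons, List.prod_cons, ih h', wordProd_cons, absorb_mul]
    rw [← wordProd_cons, h.eq, h'.eq, length_simple, List.length_cons, add_comm]

variable (Γ) in
/-- The action of the Artin-Tits monoid on pairs extending `absorb`. -/
noncomputable def absorbHom : PosMonoid Γ →* Function.End (Γ.Group × PosMonoid Γ) :=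
  PosMonoid.lift Γ (fun i => absorb (σ i)) (by
    intro i j _
    have h := isReduced_altList (Γ := Γ) j i
    rw [← Γ.symmetric i j] at h
    rw [← prod_map_altList (fun i => absorb (σ i)), ← prod_map_altList (fun i => absorb (σ i)),
      prod_map_absorb (isReduced_altList i j), prod_map_absorb h, wordProd_altList_swap])

theorem PosMonoid.lift_gen {N : Type*} [Monoid N] (f : I → N)
    (hf : ∀ i j, Γ i j ≠ 0 → altProd (Γ i j) (f i) (f j) = altProd (Γ i j) (f j) (f i)) (i : I) :
    PosMonoid.lift Γ f hf (PosMonoid.gen Γ i) = f i := rfl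

theorem PosMonoid.exists_word (x : PosMonoid Γ) :
    ∃ ω : List I, (ω.map (PosMonoid.gen Γ)).prod = x := by
  induction x using PresentedMonoid.inductionOn with
  | _ a =>
    refine ⟨a.toList, ?_⟩
    have : (PresentedMonoid.mk (monoidRel Γ)) = FreeMonoid.lift (PosMonoid.gen Γ) := by
      ext i
      rfl
    change _ = PresentedMonoid.mk (monoidRel Γ) a
    rw [this, FreeMonoid.lift_apply]

theorem PosMonoid.gen_mul_induction {p : PosMonoid Γ → Prop} (x : PosMonoid Γ) (one : p 1)
    (gen_mul : ∀ i x, p x → p (PosMonoid.gen Γ i * x)) : p x := by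
  obtain ⟨ω, rfl⟩ := PosMonoid.exists_word x
  induction ω with
  | nil => exact one
  | cons i ω ih =>
    rw [List.map_cons, List.prod_cons]
    exact gen_mul i _ ih

/-- The normal form of an element of the Artin-Tits monoid: its greatest simple left divisor, and
the corresponding quotient. -/
noncomputable def normalForm (x : PosMonoid Γ) : Γ.Group × PosMonoid Γ := absorbHom Γ x (1, 1)

theorem normalForm_gen_mul (i : I) (x : PosMonoid Γ) :
    normalForm (PosMonoid.gen Γ i * x) = absorb (σ i) (normalForm x) := by
  rw [normalForm, map_mul]
  change absorbHom Γ (PosMonoid.gen Γ i) (normalForm x) = _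
  rw [absorbHom, PosMonoid.lift_gen]

/-- Absorption only moves a factor from one side to the other, so removing v again recovers the
product of the original pair. -/
theorem simpleElt_mul_absorb_snd (v : Γ.Group) (z : Γ.Group × PosMonoid Γ) :
    simpleElt Γ (v⁻¹ * (absorb v z).1) * (absorb v z).2 = simpleElt Γ z.1 * z.2 := by
  simp only [absorb]
  rw [inv_mul_cancel_left, ← mul_assoc, ← (greatestPrefix_isPrefix v z.1).simpleElt_eq]

theorem simpleElt_absorb_fst (v : Γ.Group) (z : Γ.Group × PosMonoid Γ) :
    simpleElt Γ (absorb v z).1 = simpleElt Γ v * simpleElt Γ (v⁻¹ * (absorb v z).1) := by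
  simp only [absorb]
  rw [inv_mul_cancel_left, simpleElt_mul (length_mul_greatestPrefix v z.1)]

theorem simpleElt_normalForm_mul (x : PosMonoid Γ) :
    simpleElt Γ (normalForm x).1 * (normalForm x).2 = x := by
  induction x using PosMonoid.gen_mul_induction with
  | one =>
    rw [normalForm, map_one]
    change simpleElt Γ 1 * 1 = 1
    rw [simpleElt_one, one_mul]
  | gen_mul i x ih =>
    rw [normalForm_gen_mul, simpleElt_absorb_fst, mul_assoc, simpleElt_mul_absorb_snd, ih,
      simpleElt_simple]

/-- The normal form of s_i x determines x: strip s_i from its simple part and multiply out. -/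
instance : IsLeftCancelMul (PosMonoid Γ) where
  mul_left_cancel a := by
    induction a using PosMonoid.gen_mul_induction with
    | one =>
      intro x y h
      simpa using h
    | gen_mul i a ih =>
      intro x y h
      apply ih
      change a * x = a * y
      have h' : normalForm (PosMonoid.gen Γ i * (a * x)) =
          normalForm (PosMonoid.gen Γ i * (a * y)) := by
        rw [← mul_assoc, ← mul_assoc]
        exact congrArg _ h
      rw [normalForm_gen_mul, normalForm_gen_mul] at h'
      rw [← simpleElt_normalForm_mul (a * x), ← simpleElt_normalForm_mul (a * y),
        ← simpleElt_mul_absorb_snd (σ i), h', simpleElt_mul_absorb_snd]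

/-- The simple part of the normal form is s_i times what s_i absorbs, with additive lengths. -/
theorem isLeftDescent_normalForm {i : I} {x : PosMonoid Γ} (h : PosMonoid.gen Γ i ∣ x) :
    IsLD (normalForm x).1 i := by
  obtain ⟨y, rfl⟩ := h
  rw [normalForm_gen_mul, CoxeterSystem.IsLeftDescent]
  simp only [absorb]
  rw [simple_mul_simple_cancel_left, length_mul_greatestPrefix, length_simple]
  omega

theorem isSpherical_of_gen_dvd {D : Set I} {x : PosMonoid Γ}
    (h : ∀ i ∈ D, PosMonoid.gen Γ i ∣ x) : IsSpherical Γ D :=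
  isSpherical_of_left_descents fun i hi => isLeftDescent_normalForm (h i hi)

/-- The simple part of x has all of D among its left descents, so the elements of W_D are prefixes
of it. -/
theorem posLongest_dvd {D : Set I} {x : PosMonoid Γ} (h : ∀ i ∈ D, PosMonoid.gen Γ i ∣ x)
    (hD : IsSpherical Γ D) : posLongest Γ hD ∣ x := by
  rw [← simpleElt_normalForm_mul x]
  refine Dvd.dvd.mul_right (IsPrefix.simpleElt_dvd ?_) _
  exact isPrefix_of_left_descents (fun i hi => isLeftDescent_normalForm (h i hi))
    (longest_spec Γ hD).1

theorem gen_dvd_posLongest {D : Set I} (hD : IsSpherical Γ D) {i : I} (hi : i ∈ D) :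
    PosMonoid.gen Γ i ∣ posLongest Γ hD := by
  rw [← simpleElt_simple]
  exact ((longest_spec Γ hD).isPrefix (simple_mem_parabolic hi)).simpleElt_dvd

end NormalForm

/-! ### The action of graph automorphisms and its orbits. -/

section CoxeterAction

open CoxeterSystem

variable {I : Type*} {Γ : CoxeterMatrix I}

local notation "ℓ" => CoxeterSystem.length (CoxeterMatrix.toCoxeterSystem Γ)
local notation "σ" => CoxeterSystem.simple (CoxeterMatrix.toCoxeterSystem Γ)
local notation "π" => CoxeterSystem.wordProd (CoxeterMatrix.toCoxeterSystem Γ)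
local notation "IsRD" => CoxeterSystem.IsRightDescent (CoxeterMatrix.toCoxeterSystem Γ)
local notation "IsLD" => CoxeterSystem.IsLeftDescent (CoxeterMatrix.toCoxeterSystem Γ)

/-- The endomorphism of the Coxeter group induced by an automorphism of the Coxeter matrix. -/
def coxeterAct (g : Aut Γ) : Γ.Group →* Γ.Group :=
  Γ.toCoxeterSystem.lift ⟨fun i => σ (g • i), fun i j => by
    have e : Γ (g • i) (g • j) = Γ i j := g.2 i j
    rw [← e, simple_mul_simple_pow]⟩

theorem coxeterAct_simple (g : Aut Γ) (i : I) : coxeterAct g (σ i) = σ (g • i) :=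
  Γ.toCoxeterSystem.lift_apply_simple _ i

theorem coxeterAct_wordProd (g : Aut Γ) (ω : List I) :
    coxeterAct g (π ω) = π (ω.map (g • ·)) := by
  induction ω with
  | nil => simp
  | cons i ω ih => rw [wordProd_cons, map_mul, ih, coxeterAct_simple, List.map_cons, wordProd_cons]

theorem coxeterAct_inv_coxeterAct (g : Aut Γ) (w : Γ.Group) :
    coxeterAct g⁻¹ (coxeterAct g w) = w := by
  obtain ⟨ω, rfl⟩ := Γ.toCoxeterSystem.wordProd_surjective w
  rw [coxeterAct_wordProd, coxeterAct_wordProd, List.map_map]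
  congr 1
  simp [Function.comp_def]

theorem length_coxeterAct_le (g : Aut Γ) (w : Γ.Group) : ℓ (coxeterAct g w) ≤ ℓ w := by
  obtain ⟨ω, hω, rfl⟩ := Γ.toCoxeterSystem.exists_isReduced w
  rw [coxeterAct_wordProd, hω.eq]
  simpa using Γ.toCoxeterSystem.length_wordProd_le (ω.map (g • ·))

theorem length_coxeterAct (g : Aut Γ) (w : Γ.Group) : ℓ (coxeterAct g w) = ℓ w := by
  refine le_antisymm (length_coxeterAct_le g w) ?_
  conv_lhs => rw [← coxeterAct_inv_coxeterAct g w]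
  exact length_coxeterAct_le _ _

theorem posMonoidAct_gen (g : Aut Γ) (i : I) :
    posMonoidAct Γ g (PosMonoid.gen Γ i) = PosMonoid.gen Γ (g • i) := rfl

theorem posMonoidAct_simpleElt (g : Aut Γ) (w : Γ.Group) :
    posMonoidAct Γ g (simpleElt Γ w) = simpleElt Γ (coxeterAct g w) := by
  obtain ⟨ω, hω, rfl⟩ := Γ.toCoxeterSystem.exists_isReduced w
  have h : Γ.toCoxeterSystem.IsReduced (ω.map (g • ·)) := by
    rw [CoxeterSystem.IsReduced, ← coxeterAct_wordProd, length_coxeterAct, hω.eq, List.length_map]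
  rw [coxeterAct_wordProd, simpleElt_wordProd hω, simpleElt_wordProd h, map_list_prod,
    List.map_map, List.map_map]
  rfl

/-- The subgroup of the elements of the Coxeter group fixed by `G`. -/
def coxeterFixed (G : Subgroup (Aut Γ)) : Subgroup Γ.Group where
  carrier := {x | ∀ g ∈ G, coxeterAct g x = x}
  one_mem' := fun g _ => map_one _
  mul_mem' := by
    intro a b ha hb g hg
    rw [map_mul, ha g hg, hb g hg]
  inv_mem' := by
    intro a ha g hg
    rw [map_inv, ha g hg]

theorem coxeterAct_mem_parabolic {J : Set I} {g : Aut Γ} (hJ : ∀ i ∈ J, g • i ∈ J) {w : Γ.Group}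
    (hw : w ∈ parabolic Γ J) : coxeterAct g w ∈ parabolic Γ J := by
  induction hw using parabolic_induction with
  | one =>
    rw [map_one]
    exact one_mem _
  | mul v hv j hj ih =>
    rw [map_mul, coxeterAct_simple]
    exact mul_mem ih (simple_mem_parabolic (hJ j hj))

variable {G : Subgroup (Aut Γ)}

/-- Automorphisms preserve length, so this is the uniqueness of the longest element. -/
theorem longest_mem_coxeterFixed {J : Set I} (hJ : ∀ g ∈ G, ∀ i ∈ J, g • i ∈ J)
    (h : IsSpherical Γ J) : longest Γ h ∈ coxeterFixed G := by
  intro g hg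
  have hr := longest_spec Γ h
  refine IsLongest.unique ⟨coxeterAct_mem_parabolic (hJ g hg) hr.1, fun v hv => ?_⟩ hr
  rw [length_coxeterAct]
  exact hr.2 v hv

theorem posLongest_mem_fixedSubmonoid {J : Set I} (hJ : ∀ g ∈ G, ∀ i ∈ J, g • i ∈ J)
    (h : IsSpherical Γ J) : posLongest Γ h ∈ fixedSubmonoid Γ G := by
  intro g hg
  rw [posLongest, posMonoidAct_simpleElt, longest_mem_coxeterFixed hJ h g hg]

theorem length_mul_simple_smul {w : Γ.Group} (hw : w ∈ coxeterFixed G) {g : Aut Γ} (hg : g ∈ G)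
    (i : I) : ℓ (w * σ (g • i)) = ℓ (w * σ i) := by
  rw [← length_coxeterAct g (w * σ i), map_mul, hw g hg, coxeterAct_simple]

theorem smul_mem_of_mem_sphericalOrbits {α : Set I} (hα : α ∈ sphericalOrbits Γ G) {g : Aut Γ}
    (hg : g ∈ G) {i : I} (hi : i ∈ α) : g • i ∈ α := by
  obtain ⟨⟨j, rfl⟩, -⟩ := hα
  exact MulAction.mem_orbit_of_mem_orbit (⟨g, hg⟩ : G) hi

theorem exists_smul_eq_of_mem_sphericalOrbits {α : Set I} (hα : α ∈ sphericalOrbits Γ G) {i j : I}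
    (hi : i ∈ α) (hj : j ∈ α) : ∃ g ∈ G, g • i = j := by
  obtain ⟨⟨k, rfl⟩, -⟩ := hα
  rw [← MulAction.orbit_eq_iff.2 hi] at hj
  obtain ⟨g, hg⟩ := hj
  exact ⟨g, g.2, hg⟩

theorem nonempty_of_mem_sphericalOrbits {α : Set I} (hα : α ∈ sphericalOrbits Γ G) :
    α.Nonempty := by
  obtain ⟨⟨k, rfl⟩, -⟩ := hα
  exact MulAction.nonempty_orbit k

theorem eq_of_mem_sphericalOrbits {α β : Set I} (hα : α ∈ sphericalOrbits Γ G)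
    (hβ : β ∈ sphericalOrbits Γ G) {i : I} (hi : i ∈ α) (hi' : i ∈ β) : α = β := by
  obtain ⟨⟨j, rfl⟩, -⟩ := hα
  obtain ⟨⟨k, rfl⟩, -⟩ := hβ
  rw [← MulAction.orbit_eq_iff.2 hi, ← MulAction.orbit_eq_iff.2 hi']

theorem longest_mem_coxeterFixed_of_mem {α : Set I} (hα : α ∈ sphericalOrbits Γ G)
    (h : IsSpherical Γ α) : longest Γ h ∈ coxeterFixed G :=
  longest_mem_coxeterFixed (fun _ hg _ hi => smul_mem_of_mem_sphericalOrbits hα hg hi) h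

/-- The spherical orbits form an admissible partition of their union. -/
theorem isAdmissible_sphericalOrbits (Γ : CoxeterMatrix I) (G : Subgroup (Aut Γ)) :
    IsAdmissible Γ (sphericalOrbits Γ G) where
  nonempty _ := nonempty_of_mem_sphericalOrbits
  disjoint α hα β hβ hne := Set.disjoint_left.2 fun _ hi hi' =>
    hne (eq_of_mem_sphericalOrbits hα hβ hi hi')
  spherical _ hα := hα.2
  ascents_or_descents w hw α hα := by
    have hw' : w ∈ coxeterFixed G := by
      refine (Subgroup.closure_le _).2 ?_ hw
      rintro _ ⟨β, hβ, rfl⟩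
      exact longest_mem_coxeterFixed_of_mem hβ _
    obtain ⟨i, hi⟩ := nonempty_of_mem_sphericalOrbits hα
    refine (Γ.toCoxeterSystem.length_mul_simple w i).imp (fun h j hj => ?_) fun h j hj => ?_ <;>
    · obtain ⟨g, hg, rfl⟩ := exists_smul_eq_of_mem_sphericalOrbits hα hi hj
      rw [← length_mul_simple_smul hw' hg] at h
      exact h

theorem isLeftDescent_smul {w : Γ.Group} (hw : w ∈ coxeterFixed G) {g : Aut Γ} (hg : g ∈ G)
    {i : I} (h : IsLD w i) : IsLD w (g • i) := by
  rw [← isRightDescent_inv_iff, CoxeterSystem.IsRightDescent] at *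
  rwa [length_mul_simple_smul (inv_mem hw) hg]

theorem isLeftDescent_of_mem_sphericalOrbits {α : Set I} (hα : α ∈ sphericalOrbits Γ G)
    {w : Γ.Group} (hw : w ∈ coxeterFixed G) {i : I} (hi : i ∈ α) (h : IsLD w i) :
    ∀ j ∈ α, IsLD w j := by
  intro j hj
  obtain ⟨g, hg, rfl⟩ := exists_smul_eq_of_mem_sphericalOrbits hα hi hj
  exact isLeftDescent_smul hw hg h

/-- The exchange condition puts s_i in W_J. Then s_i has a right descent j in J, which for an
element of length one means s_i = s_j. -/
theorem mem_of_isRightDescent {J : Set I} {w : Γ.Group} (hw : w ∈ parabolic Γ J) {i : I}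
    (h : IsRD w i) : i ∈ J := by
  obtain ⟨ω, hω, rfl⟩ := exists_word_of_mem_parabolic hw
  obtain ⟨k, -, e⟩ := exchange _ h
  have hmem : σ i ∈ parabolic Γ J := by
    have : π (ω.eraseIdx k) ∈ parabolic Γ J := by
      refine Subgroup.list_prod_mem _ fun x hx => ?_
      obtain ⟨j, hj, rfl⟩ := List.mem_map.1 hx
      exact simple_mem_parabolic (hω j (List.mem_of_mem_eraseIdx hj))
    rw [← e] at this
    exact (Subgroup.mul_mem_cancel_left _ hw).1 this
  have h1 : σ i ≠ 1 := by
    intro h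
    have := Γ.toCoxeterSystem.length_simple i
    rw [h, length_one] at this
    omega
  obtain ⟨j, hj, hd⟩ := exists_isRightDescent_of_mem_parabolic hmem h1
  rw [CoxeterSystem.IsRightDescent, length_simple, Nat.lt_one_iff, length_eq_zero_iff,
    mul_eq_one_iff_eq_inv, inv_simple] at hd
  rwa [simple_injective Γ hd]

theorem length_longest_pos {J : Set I} (h : IsSpherical Γ J) (hJ : J.Nonempty) :
    0 < ℓ (longest Γ h) := by
  obtain ⟨i, hi⟩ := hJ
  exact lt_of_le_of_lt (Nat.zero_le _) ((longest_spec Γ h).isLeftDescent hi)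

theorem length_longest_mul_of_not_isLeftDescent {J : Set I} (h : IsSpherical Γ J) {w : Γ.Group}
    (hw : ∀ i ∈ J, ¬ IsLD w i) : ℓ (longest Γ h * w) = ℓ (longest Γ h) + ℓ w := by
  have := length_mul_of_ascents (w := w⁻¹) (v := (longest Γ h)⁻¹)
    (fun j hj => by rw [isRightDescent_inv_iff]; exact hw j hj) (inv_mem (longest_spec Γ h).1)
  rw [← mul_inv_rev, length_inv, length_inv, length_inv] at this
  rw [this, add_comm]

theorem length_longest_mul_of_isLeftDescent {J : Set I} (h : IsSpherical Γ J) {w : Γ.Group}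
    (hw : ∀ i ∈ J, IsLD w i) : ℓ w = ℓ (longest Γ h) + ℓ (longest Γ h * w) := by
  have := isPrefix_of_left_descents hw (longest_spec Γ h).1
  rw [IsPrefix, ← eq_inv_of_mul_eq_one_left (longest_spec Γ h).mul_self] at this
  exact this.symm

theorem isLeftDescent_longest_mul {J : Set I} (h : IsSpherical Γ J) {w : Γ.Group}
    (hl : ℓ (longest Γ h * w) = ℓ (longest Γ h) + ℓ w) {i : I} (hi : i ∈ J) :
    IsLD (longest Γ h * w) i := by
  have h1 := (longest_spec Γ h).isLeftDescent hi
  have h2 := Γ.toCoxeterSystem.length_mul_le (σ i * longest Γ h) w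
  rw [CoxeterSystem.IsLeftDescent] at *
  rw [mul_assoc] at h2
  omega

theorem not_isLeftDescent_longest_mul {J : Set I} (h : IsSpherical Γ J) {w : Γ.Group}
    (hw : ∀ i ∈ J, IsLD w i) {i : I} (hi : i ∈ J) : ¬ IsLD (longest Γ h * w) i := by
  intro hd
  have h1 := (longest_spec Γ h).isRightDescent hi
  have h2 := Γ.toCoxeterSystem.length_mul_le (longest Γ h * σ i) (σ i * (longest Γ h * w))
  rw [mul_assoc, simple_mul_simple_cancel_left, ← mul_assoc, (longest_spec Γ h).mul_self,
    one_mul] at h2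
  have h3 := length_longest_mul_of_isLeftDescent h hw
  rw [CoxeterSystem.IsLeftDescent] at hd
  rw [CoxeterSystem.IsRightDescent] at h1
  omega

end CoxeterAction

/-! ### The subgroup generated by two orbit elements r_α and r_β. -/

section Dihedral

open CoxeterSystem

variable {I : Type*} {Γ : CoxeterMatrix I}

local notation "ℓ" => CoxeterSystem.length (CoxeterMatrix.toCoxeterSystem Γ)
local notation "IsLD" => CoxeterSystem.IsLeftDescent (CoxeterMatrix.toCoxeterSystem Γ)

/-- The alternating sum `a + b + a + ⋯` with `n` terms. -/
def altSum : ℕ → ℕ → ℕ → ℕ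
  | 0, _, _ => 0
  | n + 1, a, b => a + altSum n b a

theorem altSum_le_succ (n a b : ℕ) : altSum n a b ≤ altSum (n + 1) a b := by
  induction n generalizing a b with
  | zero => simp [altSum]
  | succ n ih =>
    rw [altSum, altSum]
    exact Nat.add_le_add_left (ih b a) a

theorem altSum_mono {n m : ℕ} (h : n ≤ m) (a b : ℕ) : altSum n a b ≤ altSum m a b :=
  monotone_nat_of_le_succ (f := fun n => altSum n a b) (fun n => altSum_le_succ n a b) h

theorem altSum_lt_altSum_swap {n m : ℕ} (h : n < m) {a b : ℕ} (hb : 0 < b) :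
    altSum n a b < altSum m b a := by
  refine lt_of_lt_of_le ?_ (altSum_mono h b a)
  rw [altSum]
  omega

theorem length_altProd_le (n : ℕ) (u v : Γ.Group) :
    ℓ (altProd n u v) ≤ altSum n (ℓ u) (ℓ v) := by
  induction n generalizing u v with
  | zero => simp [altProd]
  | succ n ih =>
    rw [altProd, altSum]
    exact (length_mul_le _ _ _).trans (Nat.add_le_add_left (ih v u) _)

theorem length_altProd_of_succ {n : ℕ} {u v : Γ.Group}
    (h : ℓ (altProd (n + 1) u v) = altSum (n + 1) (ℓ u) (ℓ v)) :
    ℓ (altProd n v u) = altSum n (ℓ v) (ℓ u) := by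
  have h1 := Γ.toCoxeterSystem.length_mul_le u (altProd n v u)
  have h2 := length_altProd_le n v u
  rw [altProd, altSum] at h
  omega

theorem simpleElt_altProd {n : ℕ} {u v : Γ.Group}
    (h : ℓ (altProd n u v) = altSum n (ℓ u) (ℓ v)) :
    simpleElt Γ (altProd n u v) = altProd n (simpleElt Γ u) (simpleElt Γ v) := by
  induction n generalizing u v with
  | zero => exact simpleElt_one
  | succ n ih =>
    have h' := length_altProd_of_succ h
    rw [altProd, altProd, simpleElt_mul, ih h']
    rw [altProd, altSum] at h
    rw [h, h']

theorem length_altProd_of_le {n m : ℕ} (hnm : n ≤ m) {u v : Γ.Group}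
    (h : ℓ (altProd m u v) = altSum m (ℓ u) (ℓ v)) (h' : ℓ (altProd m v u) = altSum m (ℓ v) (ℓ u)) :
    ℓ (altProd n u v) = altSum n (ℓ u) (ℓ v) := by
  induction m, hnm using Nat.le_induction generalizing u v with
  | base => exact h
  | succ m hm ih => exact ih (length_altProd_of_succ h') (length_altProd_of_succ h)

theorem orderOf_mul_eq_of_altProd_eq {k : ℕ} (hk : 0 < k) {u v : Γ.Group} (hu : u * u = 1)
    (hv : v * v = 1) (hlu : 0 < ℓ u) (h : ℓ (altProd k u v) = altSum k (ℓ u) (ℓ v))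
    (h' : ℓ (altProd k v u) = altSum k (ℓ v) (ℓ u)) (e : altProd k u v = altProd k v u) :
    orderOf (u * v) = k := by
  rw [orderOf_eq_iff hk]
  refine ⟨(altProd_eq_altProd_swap_iff hu hv k).1 e, fun j hj hj0 hpow => ?_⟩
  rw [← altProd_eq_altProd_swap_iff hu hv] at hpow
  have h1 := length_altProd_of_le (Nat.succ_le_of_lt hj) h h'
  obtain ⟨i, rfl⟩ := Nat.exists_eq_succ_of_ne_zero hj0.ne'
  -- A relation of smaller length j would make the product of j + 1 factors start with u u, hence
  -- collapse to j - 1 factors, against additivity of lengths.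
  rw [Nat.succ_eq_add_one, altProd, ← hpow, altProd, ← mul_assoc, hu, one_mul, altSum] at h1
  have h2 := length_altProd_le i v u
  have h3 := altSum_le_succ i (ℓ v) (ℓ u)
  omega

variable {G : Subgroup (Aut Γ)}

/-- Left descents of a fixed element come in whole orbits. If α contributes none and w ≠ 1, all of β
does, r_β can be split off, and the remainder has no descent in β: the roles swap. -/
theorem exists_eq_altProd_of_not_isLeftDescent (α β : sphericalOrbits Γ G) {w : Γ.Group}
    (hfix : w ∈ coxeterFixed G) (hmem : w ∈ parabolic Γ (α ∪ β : Set I))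
    (hd : ∀ i ∈ (α : Set I), ¬ IsLD w i) :
    ∃ k, w = altProd k (longest Γ β.2.2) (longest Γ α.2.2) ∧
      ℓ w = altSum k (ℓ (longest Γ β.2.2)) (ℓ (longest Γ α.2.2)) := by
  induction hn : ℓ w using Nat.strong_induction_on generalizing α β w with
  | _ n ih =>
    by_cases h1 : w = 1
    · subst h1
      exact ⟨0, rfl, by simpa [altSum] using hn.symm⟩
    obtain ⟨i, hi, hdi⟩ := exists_isLeftDescent_of_mem_parabolic hmem h1
    have hiβ : i ∈ (β : Set I) := hi.resolve_left fun h => hd i h hdi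
    have hβ := isLeftDescent_of_mem_sphericalOrbits β.2 hfix hiβ hdi
    have hl := length_longest_mul_of_isLeftDescent β.2.2 hβ
    have hpos := length_longest_pos β.2.2 ⟨i, hiβ⟩
    have hfix' := mul_mem (longest_mem_coxeterFixed_of_mem β.2 β.2.2) hfix
    have hmem' : longest Γ β.2.2 * w ∈ parabolic Γ (β ∪ α : Set I) := by
      refine mul_mem (parabolic_mono Set.subset_union_left (longest_spec Γ β.2.2).1) ?_
      rwa [Set.union_comm]
    obtain ⟨k, e, hk⟩ := ih _ (by omega) β α hfix' hmem'
      (fun j hj => not_isLeftDescent_longest_mul β.2.2 hβ hj) rfl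
    refine ⟨k + 1, ?_, ?_⟩
    · rw [altProd, ← e, ← mul_assoc, (longest_spec Γ β.2.2).mul_self, one_mul]
    · rw [altSum, ← hk]
      omega

theorem exists_eq_altProd_of_isLeftDescent (α β : sphericalOrbits Γ G) {w : Γ.Group}
    (hfix : w ∈ coxeterFixed G) (hmem : w ∈ parabolic Γ (α ∪ β : Set I))
    (hd : ∀ i ∈ (α : Set I), IsLD w i) :
    ∃ k, 0 < k ∧ w = altProd k (longest Γ α.2.2) (longest Γ β.2.2) ∧
      ℓ w = altSum k (ℓ (longest Γ α.2.2)) (ℓ (longest Γ β.2.2)) := by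
  obtain ⟨k, e, hk⟩ := exists_eq_altProd_of_not_isLeftDescent α β
    (mul_mem (longest_mem_coxeterFixed_of_mem α.2 α.2.2) hfix)
    (mul_mem (parabolic_mono Set.subset_union_left (longest_spec Γ α.2.2).1) hmem)
    (fun j hj => not_isLeftDescent_longest_mul α.2.2 hd hj)
  refine ⟨k + 1, Nat.succ_pos k, ?_, ?_⟩
  · rw [altProd, ← e, ← mul_assoc, (longest_spec Γ α.2.2).mul_self, one_mul]
  · rw [altSum, ← hk, length_longest_mul_of_isLeftDescent α.2.2 hd]

/-- If the union of two spherical orbits is spherical, its longest element is the braid word of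
length the order of `r_α r_β` in the longest elements of these orbits. -/
theorem posLongest_union (α β : sphericalOrbits Γ G) (h : IsSpherical Γ (α ∪ β : Set I)) :
    orderOf (longest Γ α.2.2 * longest Γ β.2.2) ≠ 0 ∧
    posLongest Γ h = altProd (orderOf (longest Γ α.2.2 * longest Γ β.2.2))
      (posLongest Γ α.2.2) (posLongest Γ β.2.2) ∧
    posLongest Γ h = altProd (orderOf (longest Γ α.2.2 * longest Γ β.2.2))
      (posLongest Γ β.2.2) (posLongest Γ α.2.2) := by
  have hr := longest_spec Γ h
  have hfix : longest Γ h ∈ coxeterFixed G := by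
    refine longest_mem_coxeterFixed (fun g hg i hi => ?_) h
    exact hi.imp (smul_mem_of_mem_sphericalOrbits α.2 hg)
      (smul_mem_of_mem_sphericalOrbits β.2 hg)
  obtain ⟨k, hk, e, hl⟩ := exists_eq_altProd_of_isLeftDescent α β hfix hr.1
    (fun i hi => hr.isLeftDescent (Or.inl hi))
  obtain ⟨k', -, e', hl'⟩ := exists_eq_altProd_of_isLeftDescent β α hfix
    (by rw [Set.union_comm]; exact hr.1) (fun i hi => hr.isLeftDescent (Or.inr hi))
  have ha := length_longest_pos α.2.2 (nonempty_of_mem_sphericalOrbits α.2)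
  have hb := length_longest_pos β.2.2 (nonempty_of_mem_sphericalOrbits β.2)
  -- Both expressions have the length of the same element, and an alternating sum with more terms is
  -- strictly larger even when it starts with the other value.
  obtain rfl : k = k' := by
    rcases lt_trichotomy k k' with hlt | heq | hlt
    · have := altSum_lt_altSum_swap hlt (a := ℓ (longest Γ α.2.2)) hb
      omega
    · exact heq
    · have := altSum_lt_altSum_swap hlt (a := ℓ (longest Γ β.2.2)) ha
      omega
  rw [orderOf_mul_eq_of_altProd_eq hk (longest_spec Γ α.2.2).mul_self
    (longest_spec Γ β.2.2).mul_self ha (e ▸ hl) (e' ▸ hl') (e.symm.trans e')]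
  refine ⟨hk.ne', ?_, ?_⟩
  · rw [posLongest, e, simpleElt_altProd (e ▸ hl)]
    rfl
  · rw [posLongest, e', simpleElt_altProd (e' ▸ hl')]
    rfl

theorem altProd_mem {N S : Type*} [Monoid N] [SetLike S N] [SubmonoidClass S N] {K : S} {u v : N}
    (hu : u ∈ K) (hv : v ∈ K) (n : ℕ) : altProd n u v ∈ K := by
  induction n generalizing u v with
  | zero => exact one_mem K
  | succ n ih => exact mul_mem hu (ih hv hu)

/-- A nonempty product starting with r_β already has all of β as left descents. If prefixing r_α
failed to add lengths, α would consist of left descents too, and α ∪ β would be spherical. -/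
theorem length_altProd_of_not_isSpherical {α β : sphericalOrbits Γ G}
    (h : ¬ IsSpherical Γ (α ∪ β : Set I)) (k : ℕ) :
    ℓ (altProd k (longest Γ α.2.2) (longest Γ β.2.2)) =
      altSum k (ℓ (longest Γ α.2.2)) (ℓ (longest Γ β.2.2)) := by
  induction k generalizing α β with
  | zero => simp [altProd, altSum]
  | succ k ih =>
    have h' : ¬ IsSpherical Γ (β ∪ α : Set I) := by rwa [Set.union_comm]
    have hk := ih h'
    rw [altProd, length_longest_mul_of_not_isLeftDescent, hk, altSum]
    intro i hi hd
    have hfix := altProd_mem (longest_mem_coxeterFixed_of_mem β.2 β.2.2)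
      (longest_mem_coxeterFixed_of_mem α.2 α.2.2) k
    have hα := isLeftDescent_of_mem_sphericalOrbits α.2 hfix hi hd
    cases k with
    | zero => exact not_isLeftDescent_one _ i hd
    | succ k =>
      refine h (isSpherical_of_left_descents fun j hj => hj.elim (hα j) fun hj => ?_)
      refine isLeftDescent_longest_mul β.2.2 ?_ hj
      have := length_altProd_of_succ hk
      rw [altProd, altSum] at hk
      rw [hk, this]

/-- Otherwise both alternating products have additive length; finite order makes them equal, and
their common value has all of α and β as left descents. -/
theorem isSpherical_union_of_orderOf_ne_zero {α β : sphericalOrbits Γ G}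
    (h : orderOf (longest Γ α.2.2 * longest Γ β.2.2) ≠ 0) : IsSpherical Γ (α ∪ β : Set I) := by
  by_contra hns
  have h' : ¬ IsSpherical Γ (β ∪ α : Set I) := by rwa [Set.union_comm]
  obtain ⟨k, hk⟩ := Nat.exists_eq_succ_of_ne_zero h
  have hpow := pow_orderOf_eq_one (longest Γ α.2.2 * longest Γ β.2.2)
  rw [← altProd_eq_altProd_swap_iff (longest_spec Γ α.2.2).mul_self
    (longest_spec Γ β.2.2).mul_self, hk] at hpow
  refine hns (isSpherical_of_left_descents
    (w := altProd (k + 1) (longest Γ α.2.2) (longest Γ β.2.2)) fun j hj => ?_)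
  rcases hj with hj | hj
  · refine isLeftDescent_longest_mul α.2.2 ?_ hj
    have := length_altProd_of_not_isSpherical hns (k + 1)
    rw [altProd, altSum, ← length_altProd_of_not_isSpherical h'] at this
    exact this
  · rw [← Nat.succ_eq_add_one, hpow]
    refine isLeftDescent_longest_mul β.2.2 ?_ hj
    have := length_altProd_of_not_isSpherical h' (k + 1)
    rw [altProd, altSum, ← length_altProd_of_not_isSpherical hns] at this
    exact this

end Dihedral

/-! ### The fixed submonoid of B⁺. -/

section FixedSubmonoid

open CoxeterSystem

variable {I : Type*} {Γ : CoxeterMatrix I}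

variable (Γ) in
/-- The number of factors in any expression of an element of the Artin-Tits monoid as a product of
generators, as a morphism. -/
def degreeHom : PosMonoid Γ →* Multiplicative ℕ :=
  PosMonoid.lift Γ (fun _ => Multiplicative.ofAdd 1) fun _ _ _ => rfl

/-- The number of factors in any expression of an element of the Artin-Tits monoid as a product of
generators. -/
def degree (x : PosMonoid Γ) : ℕ := Multiplicative.toAdd (degreeHom Γ x)

theorem degree_one : degree (1 : PosMonoid Γ) = 0 := by
  rw [degree, map_one]
  rfl

theorem degree_mul (x y : PosMonoid Γ) : degree (x * y) = degree x + degree y := by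
  rw [degree, map_mul]
  rfl

theorem degree_gen (i : I) : degree (PosMonoid.gen Γ i) = 1 := rfl

theorem degree_posLongest_pos {J : Set I} (h : IsSpherical Γ J) (hJ : J.Nonempty) :
    0 < degree (posLongest Γ h) := by
  obtain ⟨i, hi⟩ := hJ
  obtain ⟨y, hy⟩ := gen_dvd_posLongest h hi
  rw [hy, degree_mul, degree_gen]
  omega

theorem PosMonoid.eq_one_or_exists_gen_mul (x : PosMonoid Γ) :
    x = 1 ∨ ∃ i y, x = PosMonoid.gen Γ i * y := by
  induction x using PosMonoid.gen_mul_induction with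
  | one => exact Or.inl rfl
  | gen_mul i x _ => exact Or.inr ⟨i, x, rfl⟩

variable (Γ) (G : Subgroup (Aut Γ))

/-- The type of the admissible partition into spherical orbits. -/
noncomputable def orbitMatrix : CoxeterMatrix (sphericalOrbits Γ G) where
  M α β := orderOf (longest Γ α.2.2 * longest Γ β.2.2)
  isSymm := by
    ext α β
    change orderOf (longest Γ β.2.2 * longest Γ α.2.2) =
      orderOf (longest Γ α.2.2 * longest Γ β.2.2)
    rw [← orderOf_inv, mul_inv_rev,
      ← eq_inv_of_mul_eq_one_left (longest_spec Γ α.2.2).mul_self,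
      ← eq_inv_of_mul_eq_one_left (longest_spec Γ β.2.2).mul_self]
  diagonal α := by rw [(longest_spec Γ α.2.2).mul_self, orderOf_one]
  off_diagonal α β hne h := by
    rw [orderOf_eq_one_iff] at h
    have e : longest Γ α.2.2 = longest Γ β.2.2 := by
      rw [eq_inv_of_mul_eq_one_left h,
        ← eq_inv_of_mul_eq_one_left (longest_spec Γ β.2.2).mul_self]
    -- An element of α is a right descent of r_α = r_β, so it lies in β, and orbits that meet
    -- coincide.
    obtain ⟨i, hi⟩ := nonempty_of_mem_sphericalOrbits α.2
    have hd := (longest_spec Γ α.2.2).isRightDescent hi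
    rw [e] at hd
    exact hne (Subtype.ext (eq_of_mem_sphericalOrbits α.2 β.2 hi
      (mem_of_isRightDescent (longest_spec Γ β.2.2).1 hd)))

theorem orbitMatrix_apply (α β : sphericalOrbits Γ G) :
    orbitMatrix Γ G α β = orderOf (longest Γ α.2.2 * longest Γ β.2.2) := rfl

theorem posLongest_braid (α β : sphericalOrbits Γ G) (h : orbitMatrix Γ G α β ≠ 0) :
    altProd (orbitMatrix Γ G α β) (posLongest Γ α.2.2) (posLongest Γ β.2.2) =
      altProd (orbitMatrix Γ G α β) (posLongest Γ β.2.2) (posLongest Γ α.2.2) := by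
  obtain ⟨-, h1, h2⟩ := posLongest_union α β (isSpherical_union_of_orderOf_ne_zero h)
  exact h1.symm.trans h2

/-- The morphism from the Artin-Tits monoid of the type of the partition into spherical orbits,
sending each generator to the longest element of the orbit. -/
noncomputable def orbitHom : PosMonoid (orbitMatrix Γ G) →* PosMonoid Γ :=
  PosMonoid.lift (orbitMatrix Γ G) (fun α => posLongest Γ α.2.2) (posLongest_braid Γ G)

variable {G}

theorem orbitHom_gen (α : sphericalOrbits Γ G) :
    orbitHom Γ G (PosMonoid.gen _ α) = posLongest Γ α.2.2 := rfl

variable {Γ}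

theorem posLongest_mem_fixedSubmonoid_of_mem {α : Set I} (hα : α ∈ sphericalOrbits Γ G)
    (h : IsSpherical Γ α) : posLongest Γ h ∈ fixedSubmonoid Γ G :=
  posLongest_mem_fixedSubmonoid (fun _ hg _ hi => smul_mem_of_mem_sphericalOrbits hα hg hi) h

theorem mem_fixedSubmonoid_of_mul_mem {x y : PosMonoid Γ} (hx : x ∈ fixedSubmonoid Γ G)
    (h : x * y ∈ fixedSubmonoid Γ G) : y ∈ fixedSubmonoid Γ G := by
  intro g hg
  have := h g hg
  rw [map_mul, hx g hg] at this
  exact mul_left_cancel this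

theorem orbitHom_mem_fixedSubmonoid (y : PosMonoid (orbitMatrix Γ G)) :
    orbitHom Γ G y ∈ fixedSubmonoid Γ G := by
  induction y using PosMonoid.gen_mul_induction with
  | one =>
    rw [map_one]
    exact one_mem _
  | gen_mul α y ih =>
    rw [map_mul]
    exact mul_mem (posLongest_mem_fixedSubmonoid_of_mem α.2 α.2.2) ih

theorem gen_smul_dvd {x : PosMonoid Γ} (hx : x ∈ fixedSubmonoid Γ G) {g : Aut Γ} (hg : g ∈ G)
    {i : I} (h : PosMonoid.gen Γ i ∣ x) : PosMonoid.gen Γ (g • i) ∣ x := by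
  rw [← hx g hg, ← posMonoidAct_gen]
  exact map_dvd _ h

/-- A generator dividing x brings its whole orbit along. Such an orbit is spherical, its longest
element divides x, and the fixed quotient has smaller degree. -/
theorem exists_orbitHom_eq {x : PosMonoid Γ} (hx : x ∈ fixedSubmonoid Γ G) :
    ∃ y, orbitHom Γ G y = x := by
  induction hn : degree x using Nat.strong_induction_on generalizing x with
  | _ n ih =>
    obtain rfl | ⟨i, z, hz⟩ := PosMonoid.eq_one_or_exists_gen_mul x
    · exact ⟨1, map_one _⟩
    have hdvd : ∀ j ∈ MulAction.orbit G i, PosMonoid.gen Γ j ∣ x := by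
      rintro _ ⟨g, rfl⟩
      exact gen_smul_dvd hx g.2 ⟨z, hz⟩
    let α : sphericalOrbits Γ G := ⟨MulAction.orbit G i, ⟨i, rfl⟩, isSpherical_of_gen_dvd hdvd⟩
    obtain ⟨y, hxy⟩ := posLongest_dvd hdvd α.2.2
    have hy := mem_fixedSubmonoid_of_mul_mem (posLongest_mem_fixedSubmonoid_of_mem α.2 α.2.2)
      (hxy ▸ hx)
    have hpos := degree_posLongest_pos α.2.2 (nonempty_of_mem_sphericalOrbits α.2)
    rw [hxy, degree_mul] at hn
    obtain ⟨y', rfl⟩ := ih _ (by omega) hy rfl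
    exact ⟨PosMonoid.gen _ α * y', by rw [map_mul, orbitHom_gen, hxy]⟩

/-- The pattern is Matsumoto's. If words starting with α and β have the same image, r_{α ∪ β}
divides it, with a fixed quotient that lifts to the source. Each word is compared, after cancelling
its first letter, with a side of the braid relation times this lift. -/
theorem orbitHom_injective : Function.Injective (orbitHom Γ G) := by
  intro x y h
  induction hn : degree (orbitHom Γ G x) using Nat.strong_induction_on generalizing x y with
  | _ n ih =>
    have hpos := fun α : sphericalOrbits Γ G =>
      degree_posLongest_pos α.2.2 (nonempty_of_mem_sphericalOrbits α.2)
    obtain rfl | ⟨α, x, rfl⟩ := PosMonoid.eq_one_or_exists_gen_mul x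
    · obtain rfl | ⟨β, y, rfl⟩ := PosMonoid.eq_one_or_exists_gen_mul y
      · rfl
      · have := congrArg degree h
        rw [map_one, degree_one, map_mul, degree_mul, orbitHom_gen] at this
        have := hpos β
        omega
    obtain rfl | ⟨β, y, rfl⟩ := PosMonoid.eq_one_or_exists_gen_mul y
    · have := congrArg degree h
      rw [map_one, degree_one, map_mul, degree_mul, orbitHom_gen] at this
      have := hpos α
      omega
    have hdvd : ∀ i ∈ (α ∪ β : Set I), PosMonoid.gen Γ i ∣
        orbitHom Γ G (PosMonoid.gen _ α * x) := by
      rintro i (hi | hi)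
      · rw [map_mul]
        exact (gen_dvd_posLongest α.2.2 hi).mul_right _
      · rw [h, map_mul]
        exact (gen_dvd_posLongest β.2.2 hi).mul_right _
    have hsph := isSpherical_of_gen_dvd hdvd
    obtain ⟨hm, e1, e2⟩ := posLongest_union α β hsph
    obtain ⟨z, hz⟩ := posLongest_dvd hdvd hsph
    rw [← orbitMatrix_apply] at hm e1 e2
    have e1' : posLongest Γ hsph = orbitHom Γ G (altProd (orbitMatrix Γ G α β)
        (PosMonoid.gen _ α) (PosMonoid.gen _ β)) := by
      rw [map_altProd, e1]
      rfl
    have hzfix : z ∈ fixedSubmonoid Γ G := by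
      refine mem_fixedSubmonoid_of_mul_mem ?_ (hz ▸ orbitHom_mem_fixedSubmonoid _)
      rw [e1']
      exact orbitHom_mem_fixedSubmonoid _
    obtain ⟨z, rfl⟩ := exists_orbitHom_eq hzfix
    have hb := PosMonoid.gen_braid (orbitMatrix Γ G) α β hm
    -- The exponent stays that of (α, β), so the claim serves both orders; it is nonzero, so the
    -- first letter can be cancelled and the degree drops.
    have key : ∀ (γ δ : sphericalOrbits Γ G) (t : PosMonoid (orbitMatrix Γ G)),
        orbitHom Γ G (PosMonoid.gen _ γ * t) = orbitHom Γ G (altProd (orbitMatrix Γ G α β)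
          (PosMonoid.gen _ γ) (PosMonoid.gen _ δ) * z) →
        degree (orbitHom Γ G (PosMonoid.gen _ γ * t)) = n →
        PosMonoid.gen _ γ * t = altProd (orbitMatrix Γ G α β)
          (PosMonoid.gen _ γ) (PosMonoid.gen _ δ) * z := by
      intro γ δ t ht hdeg
      obtain ⟨m, hm'⟩ := Nat.exists_eq_succ_of_ne_zero hm
      rw [hm', Nat.succ_eq_add_one, altProd, mul_assoc] at ht ⊢
      rw [map_mul, map_mul] at ht
      rw [map_mul, degree_mul, orbitHom_gen] at hdeg
      have := hpos γ
      rw [ih _ (by omega) (mul_left_cancel ht) rfl]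
    rw [e1', ← map_mul] at hz
    rw [key α β x hz hn, hb]
    refine (key β α y ?_ (h ▸ hn)).symm
    rw [← h, hz, hb]

variable (Γ G)

theorem fixedSubmonoid_eq_closure : fixedSubmonoid Γ G =
    Submonoid.closure (Set.range fun α : sphericalOrbits Γ G => posLongest Γ α.2.2) := by
  apply le_antisymm
  · intro x hx
    obtain ⟨y, rfl⟩ := exists_orbitHom_eq hx
    induction y using PosMonoid.gen_mul_induction with
    | one =>
      rw [map_one]
      exact one_mem _
    | gen_mul α y ih =>
      rw [map_mul]
      exact mul_mem (Submonoid.subset_closure ⟨α, rfl⟩) (ih (orbitHom_mem_fixedSubmonoid y))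
  · rw [Submonoid.closure_le]
    rintro _ ⟨α, rfl⟩
    exact posLongest_mem_fixedSubmonoid_of_mem α.2 α.2.2

/-- The Artin-Tits monoid of the type of the partition into spherical orbits is isomorphic to the
submonoid of fixed elements. -/
noncomputable def orbitEquiv : PosMonoid (orbitMatrix Γ G) ≃* fixedSubmonoid Γ G :=
  MulEquiv.ofBijective ((orbitHom Γ G).codRestrict _ orbitHom_mem_fixedSubmonoid)
    ⟨fun _ _ h => orbitHom_injective (congrArg Subtype.val h), fun x => by
      obtain ⟨y, hy⟩ := exists_orbitHom_eq x.2
      exact ⟨y, Subtype.ext hy⟩⟩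

theorem orbitEquiv_gen (α : sphericalOrbits Γ G) :
    (orbitEquiv Γ G (PosMonoid.gen _ α) : PosMonoid Γ) = posLongest Γ α.2.2 := rfl

end FixedSubmonoid

/-! ### Embedding B⁺ in B by inverting a central element. -/

section GroupOfFractions

variable {I : Type*} {Γ : CoxeterMatrix I}

theorem toArtinGroup_gen (i : I) :
    toArtinGroup Γ (PosMonoid.gen Γ i) = ArtinGroup.gen Γ i := rfl

theorem ArtinGroup.lift_gen {N : Type*} [Group N] (f : I → N)
    (hf : ∀ i j, Γ i j ≠ 0 → altProd (Γ i j) (f i) (f j) = altProd (Γ i j) (f j) (f i)) (i : I) :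
    ArtinGroup.lift Γ f hf (ArtinGroup.gen Γ i) = f i :=
  PresentedGroup.toGroup.of _

theorem PosMonoid.hom_ext {N : Type*} [Monoid N] {f g : PosMonoid Γ →* N}
    (h : ∀ i, f (PosMonoid.gen Γ i) = g (PosMonoid.gen Γ i)) : f = g := by
  refine MonoidHom.ext fun x => ?_
  induction x using PosMonoid.gen_mul_induction with
  | one => rw [map_one, map_one]
  | gen_mul i x ih => rw [map_mul, map_mul, ih, h]

/-- The powers of a central element form an Ore set. -/
@[reducible]
def oreSetPowers {M : Type*} [Monoid M] {δ : M} (hδ : ∀ x, Commute δ x) :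
    OreLocalization.OreSet (Submonoid.powers δ) where
  ore_right_cancel r₁ r₂ s h := ⟨s, by
    obtain ⟨_, k, rfl⟩ := s
    have h1 := ((hδ r₁).pow_left k).eq
    have h2 := ((hδ r₂).pow_left k).eq
    simp only at h h1 h2 ⊢
    rw [h1, h2, h]⟩
  oreNum r _ := r
  oreDenom _ s := s
  ore_eq r s := by
    obtain ⟨_, k, rfl⟩ := s
    exact ((hδ r).pow_left k).eq

/-- If the Artin-Tits monoid has a central element that is a multiple of all generators, it embeds
into the Artin-Tits group. -/
theorem toArtinGroup_injective_of_central {δ : PosMonoid Γ} (hδ : ∀ x, Commute δ x)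
    (hgen : ∀ i, PosMonoid.gen Γ i ∣ δ) : Function.Injective (toArtinGroup Γ) := by
  let _ := oreSetPowers hδ
  let S := Submonoid.powers δ
  let ι : PosMonoid Γ →* OreLocalization S (PosMonoid Γ) := OreLocalization.numeratorHom
  -- Centrality and cancellation turn δ = s_i y into y s_i = δ, so inverting δ inverts s_i on both
  -- sides.
  have hunit : ∀ i, IsUnit (ι (PosMonoid.gen Γ i)) := by
    intro i
    obtain ⟨y, hy⟩ := hgen i
    have hy' : y * PosMonoid.gen Γ i = δ := by
      apply mul_left_cancel (a := PosMonoid.gen Γ i)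
      rw [← mul_assoc, ← hy, (hδ _).eq]
    have hu : IsUnit (ι δ) :=
      OreLocalization.numerator_isUnit (⟨δ, Submonoid.mem_powers δ⟩ : S)
    obtain ⟨d, hd⟩ := hu
    rw [isUnit_iff_exists]
    have e1 : ι (PosMonoid.gen Γ i) * (ι y * ↑d⁻¹) = 1 := by
      rw [← mul_assoc, ← map_mul, ← hy, ← hd, Units.mul_inv]
    have e2 : (↑d⁻¹ * ι y) * ι (PosMonoid.gen Γ i) = 1 := by
      rw [mul_assoc, ← map_mul, hy', ← hd, Units.inv_mul]
    refine ⟨_, e1, ?_⟩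
    rw [← left_inv_eq_right_inv e2 e1, e2]
  choose u hu using hunit
  let F : ArtinGroup Γ →* (OreLocalization S (PosMonoid Γ))ˣ :=
    ArtinGroup.lift Γ u (by
      intro i j h
      ext
      have := congrArg ι (PosMonoid.gen_braid Γ i j h)
      rw [map_altProd, map_altProd] at this
      rw [← Units.coeHom_apply, ← Units.coeHom_apply, map_altProd, map_altProd]
      simpa [hu] using this)
  have hF : ((Units.coeHom _).comp F).comp (toArtinGroup Γ) = ι := by
    apply PosMonoid.hom_ext
    intro i
    rw [← hu]
    exact congrArg Units.val (ArtinGroup.lift_gen u _ i)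
  intro x y hxy
  have h : ι x = ι y := by
    rw [← hF]
    exact congrArg (fun b => (F b : OreLocalization S (PosMonoid Γ))) hxy
  change x /ₒ (1 : S) = y /ₒ (1 : S) at h
  rw [OreLocalization.oreDiv_eq_iff] at h
  obtain ⟨v, w, h1, h2⟩ := h
  obtain ⟨_, k, rfl⟩ := v
  have hw : δ ^ k = w := by simpa using h2
  subst hw
  exact (mul_left_cancel h1).symm

/-- If the Artin-Tits monoid has a central element that is a multiple of all generators, every
element of the Artin-Tits group is a fraction whose denominator is a power of this element. -/
theorem exists_toArtinGroup_pow_mul_eq {δ : PosMonoid Γ} (hδ : ∀ x, Commute δ x)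
    (hgen : ∀ i, PosMonoid.gen Γ i ∣ δ) (b : ArtinGroup Γ) :
    ∃ (k : ℕ) (x : PosMonoid Γ), toArtinGroup Γ δ ^ k * b = toArtinGroup Γ x := by
  have hmem : ∀ b : ArtinGroup Γ, b ∈ Subgroup.closure (Set.range (ArtinGroup.gen Γ)) := by
    intro b
    have : Subgroup.closure (Set.range (ArtinGroup.gen Γ)) = ⊤ :=
      PresentedGroup.closure_range_of _
    rw [this]
    trivial
  have hcomm : ∀ b : ArtinGroup Γ, Commute (toArtinGroup Γ δ) b := by
    intro b
    have hb := hmem b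
    induction hb using Subgroup.closure_induction with
    | mem x hx =>
      obtain ⟨i, rfl⟩ := hx
      exact (hδ (PosMonoid.gen Γ i)).map (toArtinGroup Γ)
    | one => exact Commute.one_right _
    | mul x y _ _ h h' => exact h.mul_right h'
    | inv x _ h => exact h.inv_right
  have hb := hmem b
  induction hb using Subgroup.closure_induction_right with
  | one => exact ⟨0, 1, by simp⟩
  | mul_right b _ c hc ih =>
    obtain ⟨i, rfl⟩ := hc
    obtain ⟨k, x, h⟩ := ih
    exact ⟨k, x * PosMonoid.gen Γ i, by rw [← mul_assoc, h, map_mul, toArtinGroup_gen]⟩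
  | mul_inv_cancel b _ c hc ih =>
    obtain ⟨i, rfl⟩ := hc
    obtain ⟨k, x, h⟩ := ih
    obtain ⟨y, hy⟩ := hgen i
    -- One more factor δ = s_i y, moved past b by centrality, absorbs the inverse of s_i and leaves
    -- y.
    refine ⟨k + 1, x * y, ?_⟩
    have e : toArtinGroup Γ δ = ArtinGroup.gen Γ i * toArtinGroup Γ y := by
      rw [hy, map_mul, toArtinGroup_gen]
    calc toArtinGroup Γ δ ^ (k + 1) * (b * (ArtinGroup.gen Γ i)⁻¹)
        = toArtinGroup Γ δ ^ k * (toArtinGroup Γ δ * (b * (ArtinGroup.gen Γ i)⁻¹)) := by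
          rw [pow_succ, mul_assoc]
      _ = toArtinGroup Γ δ ^ k * (b * toArtinGroup Γ y) := by
          rw [(hcomm _).eq, e, mul_assoc b, inv_mul_cancel_left]
      _ = toArtinGroup Γ (x * y) := by rw [← mul_assoc, h, map_mul]

end GroupOfFractions

/-! ### Finite Coxeter groups and the fixed subgroup of B. -/

section SphericalType

open CoxeterSystem

variable {I : Type*} {Γ : CoxeterMatrix I}

local notation "ℓ" => CoxeterSystem.length (CoxeterMatrix.toCoxeterSystem Γ)
local notation "σ" => CoxeterSystem.simple (CoxeterMatrix.toCoxeterSystem Γ)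

theorem mem_parabolic_univ (w : Γ.Group) : w ∈ parabolic Γ Set.univ := by
  have h : parabolic Γ Set.univ = ⊤ := by
    rw [parabolic, Set.image_univ]
    exact Γ.toCoxeterSystem.subgroup_closure_range_simple
  rw [h]
  trivial

theorem length_longest_univ_mul (h : IsSpherical Γ Set.univ) (w : Γ.Group) :
    ℓ (longest Γ h * w) + ℓ w = ℓ (longest Γ h) := by
  have := length_mul_inv_add_of_descents (J := Set.univ)
    (fun j hj => (longest_spec Γ h).isRightDescent hj) (mem_parabolic_univ w⁻¹)
  rwa [inv_inv, length_inv] at this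

theorem length_mul_longest_univ (h : IsSpherical Γ Set.univ) (w : Γ.Group) :
    ℓ (w * longest Γ h) + ℓ w = ℓ (longest Γ h) := by
  have := length_longest_univ_mul h w⁻¹
  rwa [eq_inv_of_mul_eq_one_left (longest_spec Γ h).mul_self, ← mul_inv_rev, length_inv,
    length_inv, ← eq_inv_of_mul_eq_one_left (longest_spec Γ h).mul_self] at this

/-- Conjugation by the longest element permutes the generators of the Artin-Tits monoid. -/
theorem exists_posLongest_univ_mul_gen (h : IsSpherical Γ Set.univ) (i : I) :
    ∃ j, posLongest Γ h * PosMonoid.gen Γ i = PosMonoid.gen Γ j * posLongest Γ h ∧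
      posLongest Γ h * PosMonoid.gen Γ j = PosMonoid.gen Γ i * posLongest Γ h := by
  have hr := (longest_spec Γ h).mul_self
  have h1 : ∀ k, ℓ (longest Γ h * σ k) + 1 = ℓ (longest Γ h) := fun k => by
    have := length_longest_univ_mul h (σ k)
    rwa [length_simple] at this
  have h1' : ∀ k, ℓ (σ k * longest Γ h) + 1 = ℓ (longest Γ h) := fun k => by
    have := length_mul_longest_univ h (σ k)
    rwa [length_simple] at this
  have h2 := length_mul_longest_univ h (longest Γ h * σ i)
  have h3 := h1 i
  -- Multiplying by r on either side complements lengths in ℓ(r), so r s_i r has length 1.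
  obtain ⟨j, hj⟩ := (Γ.toCoxeterSystem.length_eq_one_iff
    (w := longest Γ h * σ i * longest Γ h)).1 (by omega)
  have hij : longest Γ h * σ i = σ j * longest Γ h := by
    rw [← hj, mul_assoc, hr, mul_one]
  have hji : longest Γ h * σ j = σ i * longest Γ h := by
    rw [← hj, mul_assoc, ← mul_assoc, hr, one_mul]
  have hfac : ∀ k, posLongest Γ h = simpleElt Γ (longest Γ h * σ k) * PosMonoid.gen Γ k := by
    intro k
    rw [← simpleElt_simple, ← simpleElt_mul, simple_mul_simple_cancel_right]
    · rfl
    · rw [simple_mul_simple_cancel_right, length_simple, h1]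
  have hfac' : ∀ k, posLongest Γ h = PosMonoid.gen Γ k * simpleElt Γ (σ k * longest Γ h) := by
    intro k
    rw [← simpleElt_simple, ← simpleElt_mul, simple_mul_simple_cancel_left]
    · rfl
    · rw [simple_mul_simple_cancel_left, length_simple, add_comm, h1']
  have key : ∀ k l, longest Γ h * σ k = σ l * longest Γ h →
      posLongest Γ h * PosMonoid.gen Γ k = PosMonoid.gen Γ l * posLongest Γ h := by
    intro k l hkl
    -- Both sides become s_l · (r s_k) · s_k, with r s_k = s_l r a simple element.
    conv_lhs => rw [hfac' l, ← hkl]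
    conv_rhs => rw [hfac k]
    rw [mul_assoc]
  exact ⟨j, key i j hij, key j i hji⟩

/-- Conjugation by the longest element permutes the generators by an involution, so its square is
central. -/
theorem commute_posLongest_univ_sq (h : IsSpherical Γ Set.univ) (x : PosMonoid Γ) :
    Commute (posLongest Γ h * posLongest Γ h) x := by
  induction x using PosMonoid.gen_mul_induction with
  | one => exact Commute.one_right _
  | gen_mul i x ih =>
    refine Commute.mul_right ?_ ih
    obtain ⟨j, h1, h2⟩ := exists_posLongest_univ_mul_gen h i
    rw [Commute, SemiconjBy, mul_assoc, h1, ← mul_assoc, h2, mul_assoc]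

theorem gen_dvd_posLongest_univ_sq (h : IsSpherical Γ Set.univ) (i : I) :
    PosMonoid.gen Γ i ∣ posLongest Γ h * posLongest Γ h :=
  (gen_dvd_posLongest h (Set.mem_univ i)).mul_right _

variable {G : Subgroup (Aut Γ)}

theorem posLongest_univ_mem_fixedSubmonoid (h : IsSpherical Γ Set.univ) :
    posLongest Γ h ∈ fixedSubmonoid Γ G :=
  posLongest_mem_fixedSubmonoid (fun _ _ _ _ => Set.mem_univ _) h

theorem artinGroupAct_toArtinGroup (g : Aut Γ) (x : PosMonoid Γ) :
    artinGroupAct Γ g (toArtinGroup Γ x) = toArtinGroup Γ (posMonoidAct Γ g x) := by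
  have : (artinGroupAct Γ g : ArtinGroup Γ →* ArtinGroup Γ).comp (toArtinGroup Γ) =
      (toArtinGroup Γ).comp (posMonoidAct Γ g) := by
    apply PosMonoid.hom_ext
    intro i
    change artinGroupAct Γ g (ArtinGroup.gen Γ i) = _
    rw [artinGroupAct, ArtinGroup.lift_gen]
    rfl
  exact DFunLike.congr_fun this x

theorem toArtinGroup_mem_fixedSubgroup {x : PosMonoid Γ} (hx : x ∈ fixedSubmonoid Γ G) :
    toArtinGroup Γ x ∈ fixedSubgroup Γ G := fun g hg => by
  rw [artinGroupAct_toArtinGroup, hx g hg]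

variable (Γ G)

/-- The morphism from the Artin-Tits group of the type of the partition into spherical orbits,
sending each generator to the longest element of the orbit. -/
noncomputable def orbitGroupHom : ArtinGroup (orbitMatrix Γ G) →* ArtinGroup Γ :=
  ArtinGroup.lift (orbitMatrix Γ G) (fun α => artinLongest Γ α.2.2) fun α β h => by
    rw [artinLongest, artinLongest, ← map_altProd, posLongest_braid Γ G α β h, map_altProd]

variable {G}

theorem orbitGroupHom_gen (α : sphericalOrbits Γ G) :
    orbitGroupHom Γ G (ArtinGroup.gen _ α) = artinLongest Γ α.2.2 :=
  ArtinGroup.lift_gen _ _ α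

theorem orbitGroupHom_toArtinGroup (x : PosMonoid (orbitMatrix Γ G)) :
    orbitGroupHom Γ G (toArtinGroup _ x) = toArtinGroup Γ (orbitHom Γ G x) := by
  have : (orbitGroupHom Γ G).comp (toArtinGroup _) = (toArtinGroup Γ).comp (orbitHom Γ G) := by
    apply PosMonoid.hom_ext
    intro α
    exact orbitGroupHom_gen Γ α
  exact DFunLike.congr_fun this x

variable {Γ}

theorem artinLongest_mem_fixedSubgroup (α : sphericalOrbits Γ G) :
    artinLongest Γ α.2.2 ∈ fixedSubgroup Γ G :=
  toArtinGroup_mem_fixedSubgroup (posLongest_mem_fixedSubmonoid_of_mem α.2 α.2.2)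

theorem range_orbitGroupHom : (orbitGroupHom Γ G).range =
    Subgroup.closure (Set.range fun α : sphericalOrbits Γ G => artinLongest Γ α.2.2) := by
  have h : Subgroup.closure (Set.range (ArtinGroup.gen (orbitMatrix Γ G))) = ⊤ :=
    PresentedGroup.closure_range_of _
  rw [MonoidHom.range_eq_map, ← h, MonoidHom.map_closure, ← Set.range_comp]
  congr 2
  funext α
  exact orbitGroupHom_gen Γ α

/-- The central square has a preimage δ in the monoid of the type, and injectivity of `orbitHom`
makes δ central and a multiple of all generators there. An element of the kernel is thus a fraction
δ^{-k} x; δ^k and x have the same image in B, hence in B⁺, hence are equal. -/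
theorem orbitGroupHom_injective (h : IsSpherical Γ Set.univ) :
    Function.Injective (orbitGroupHom Γ G) := by
  have hfix : posLongest Γ h * posLongest Γ h ∈ fixedSubmonoid Γ G :=
    mul_mem (posLongest_univ_mem_fixedSubmonoid h) (posLongest_univ_mem_fixedSubmonoid h)
  obtain ⟨δ, hδ⟩ := exists_orbitHom_eq hfix
  have hcomm : ∀ x, Commute δ x := fun x => by
    apply orbitHom_injective
    rw [map_mul, map_mul, hδ]
    exact commute_posLongest_univ_sq h _
  have hgen : ∀ α, PosMonoid.gen _ α ∣ δ := by
    intro α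
    obtain ⟨y, hy⟩ := (posLongest_dvd (fun i _ => gen_dvd_posLongest_univ_sq h i) α.2.2 :
      posLongest Γ α.2.2 ∣ posLongest Γ h * posLongest Γ h)
    obtain ⟨z, rfl⟩ := exists_orbitHom_eq (mem_fixedSubmonoid_of_mul_mem
      (posLongest_mem_fixedSubmonoid_of_mem α.2 α.2.2) (hy ▸ hfix))
    refine ⟨z, orbitHom_injective ?_⟩
    rw [hδ, hy, map_mul, orbitHom_gen]
  rw [injective_iff_map_eq_one]
  intro b hb
  obtain ⟨k, x, hx⟩ := exists_toArtinGroup_pow_mul_eq hcomm hgen b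
  have e := congrArg (orbitGroupHom Γ G) hx
  rw [map_mul, hb, mul_one, ← map_pow, orbitGroupHom_toArtinGroup,
    orbitGroupHom_toArtinGroup] at e
  have e' := orbitHom_injective (toArtinGroup_injective_of_central (commute_posLongest_univ_sq h)
    (gen_dvd_posLongest_univ_sq h) e)
  rwa [← e', map_pow, mul_eq_left] at hx

/-- The denominator, a power of the central square, is fixed. So for fixed b the numerator is fixed
in B, hence in B⁺ by the embedding, and both lift to the monoid of the type. -/
theorem exists_orbitGroupHom_eq (h : IsSpherical Γ Set.univ) {b : ArtinGroup Γ}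
    (hb : b ∈ fixedSubgroup Γ G) : ∃ c, orbitGroupHom Γ G c = b := by
  have hfix : posLongest Γ h * posLongest Γ h ∈ fixedSubmonoid Γ G :=
    mul_mem (posLongest_univ_mem_fixedSubmonoid h) (posLongest_univ_mem_fixedSubmonoid h)
  obtain ⟨k, x, hx⟩ := exists_toArtinGroup_pow_mul_eq (commute_posLongest_univ_sq h)
    (gen_dvd_posLongest_univ_sq h) b
  have hxfix : x ∈ fixedSubmonoid Γ G := by
    intro g hg
    apply toArtinGroup_injective_of_central (commute_posLongest_univ_sq h)
      (gen_dvd_posLongest_univ_sq h)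
    rw [← artinGroupAct_toArtinGroup, ← hx]
    exact mul_mem (pow_mem (toArtinGroup_mem_fixedSubgroup hfix) k) hb g hg
  obtain ⟨δ, hδ⟩ := exists_orbitHom_eq hfix
  obtain ⟨y, rfl⟩ := exists_orbitHom_eq hxfix
  refine ⟨(toArtinGroup _ δ ^ k)⁻¹ * toArtinGroup _ y, ?_⟩
  rw [map_mul, map_inv, map_pow, orbitGroupHom_toArtinGroup, orbitGroupHom_toArtinGroup, hδ,
    ← hx, inv_mul_cancel_left]

theorem orbitGroupHom_mem_fixedSubgroup (c : ArtinGroup (orbitMatrix Γ G)) :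
    orbitGroupHom Γ G c ∈ fixedSubgroup Γ G := by
  have h : (orbitGroupHom Γ G).range ≤ fixedSubgroup Γ G := by
    rw [range_orbitGroupHom, Subgroup.closure_le]
    rintro _ ⟨α, rfl⟩
    exact artinLongest_mem_fixedSubgroup α
  exact h ⟨c, rfl⟩

theorem fixedSubgroup_eq_closure (h : IsSpherical Γ Set.univ) : fixedSubgroup Γ G =
    Subgroup.closure (Set.range fun α : sphericalOrbits Γ G => artinLongest Γ α.2.2) := by
  rw [← range_orbitGroupHom]
  refine le_antisymm (fun b hb => exists_orbitGroupHom_eq h hb) ?_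
  rintro _ ⟨c, rfl⟩
  exact orbitGroupHom_mem_fixedSubgroup c

/-- When the Coxeter group is finite, the Artin-Tits group of the type of the partition into
spherical orbits is isomorphic to the subgroup of fixed elements. -/
noncomputable def orbitGroupEquiv (h : IsSpherical Γ Set.univ) :
    ArtinGroup (orbitMatrix Γ G) ≃* fixedSubgroup Γ G :=
  MulEquiv.ofBijective ((orbitGroupHom Γ G).codRestrict _ orbitGroupHom_mem_fixedSubgroup)
    ⟨fun _ _ e => orbitGroupHom_injective h (congrArg Subtype.val e), fun b => by
      obtain ⟨c, hc⟩ := exists_orbitGroupHom_eq h b.2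
      exact ⟨c, Subtype.ext hc⟩⟩

theorem orbitGroupEquiv_gen (h : IsSpherical Γ Set.univ) (α : sphericalOrbits Γ G) :
    (orbitGroupEquiv h (ArtinGroup.gen _ α) : ArtinGroup Γ) = artinLongest Γ α.2.2 :=
  orbitGroupHom_gen Γ α

end SphericalType

end ArtinTits

theorem theorem3p7 {I : Type*} (Γ : CoxeterMatrix I) (G : Subgroup (ArtinTits.Aut Γ)) :
    -- the spherical orbits form an admissible partition of their union
    ArtinTits.IsAdmissible Γ (ArtinTits.sphericalOrbits Γ G) ∧
    -- the type of this partition, which is a Coxeter matrix (`0` stands for `∞`)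
    ∃ Γt : CoxeterMatrix (ArtinTits.sphericalOrbits Γ G),
      (∀ α β : ArtinTits.sphericalOrbits Γ G,
        Γt α β = orderOf (ArtinTits.longest Γ α.2.2 * ArtinTits.longest Γ β.2.2)) ∧
      -- the Artin-Tits monoid
      (ArtinTits.fixedSubmonoid Γ G =
          Submonoid.closure (Set.range fun α : ArtinTits.sphericalOrbits Γ G =>
            ArtinTits.posLongest Γ α.2.2) ∧
        ∃ f : ArtinTits.PosMonoid Γt ≃* ArtinTits.fixedSubmonoid Γ G,
          ∀ α : ArtinTits.sphericalOrbits Γ G,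
            (f (ArtinTits.PosMonoid.gen Γt α) : ArtinTits.PosMonoid Γ) =
              ArtinTits.posLongest Γ α.2.2) ∧
      -- the Artin-Tits group, when the Coxeter group is finite
      (Finite Γ.Group →
        ArtinTits.fixedSubgroup Γ G =
          Subgroup.closure (Set.range fun α : ArtinTits.sphericalOrbits Γ G =>
            ArtinTits.artinLongest Γ α.2.2) ∧
        ∃ f : ArtinTits.ArtinGroup Γt ≃* ArtinTits.fixedSubgroup Γ G,
          ∀ α : ArtinTits.sphericalOrbits Γ G,
            (f (ArtinTits.ArtinGroup.gen Γt α) : ArtinTits.ArtinGroup Γ) =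
              ArtinTits.artinLongest Γ α.2.2) := by
  refine ⟨ArtinTits.isAdmissible_sphericalOrbits Γ G, ArtinTits.orbitMatrix Γ G,
    ArtinTits.orbitMatrix_apply Γ G, ⟨ArtinTits.fixedSubmonoid_eq_closure Γ G,
      ArtinTits.orbitEquiv Γ G, ArtinTits.orbitEquiv_gen Γ G⟩, fun hfin => ?_⟩
  have h : ArtinTits.IsSpherical Γ Set.univ := Set.toFinite _
  exact ⟨ArtinTits.fixedSubgroup_eq_closure h, ArtinTits.orbitGroupEquiv h,
    ArtinTits.orbitGroupEquiv_gen h⟩
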